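/- **Setting.** Let $E$ be a finite-dimensional real vector space with a norm $\|\cdot\|$ and dual norm $\|\cdot\|_*$, let $X\subseteq E$ be compact and convex, and let $\psi:X\to\mathbb R$ be differentiable and $1$-strongly convex with respect to $\|\cdot\|$, with Bregman divergence $D(x,y)=\psi(x)-\psi(y)-\langle\nabla\psi(y),x-y\rangle\le\frac12R^2$ for all $x,y\in X$, where $R\ge 0$. There are $n\ge 2$ processors; processor $i$ has a probability distribution $\Pi_i$ on a measurable space $\Xi$. For each $\xi\in\Xi$ the function $F(\cdot;\xi)$ is convex on $X$, $F(x;\cdot)$ is measurable and $\Pi_i$-integrable for all $x\in X$ and all $i$, and $$f(x)=\frac1n\sum_{i=1}^n\mathbb E_{\Pi_i}[F(x;\xi)].$$ Let $\mathsf G(x;\xi)\in\partial F(x;\xi)$ be a jointly measurable selection of subgradients, i.e. $F(y;\xi)\ge F(x;\xi)+\langle \mathsf G(x;\xi),y-x\rangle$ for $x,y\in X$. For every $i$ and $\Pi_i$-almost every $\xi$, $F(\cdot;\xi)$ is $G$-Lipschitz on $X$ with respect to $\|\cdot\|$ and $\|\mathsf G(x;\xi)\|_*\le G$ for all $x\in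 X$. Let $P(1),P(2),\dots$ be i.i.d. random doubly stochastic $n\times n$ matrices. A token starts at an arbitrary, possibly random, $i(0)\in\{1,\dots,n\}$. At time $t\ge1$ the matrix $P(t)$ is drawn independently of the past; given the past and $P(t)$, the token moves from $i(t-1)$ to $i(t)=j$ with probability $P(t)_{i(t-1),j}$; given all this and $i(t)$, a sample $\xi_t$ is drawn from $\Pi_{i(t)}$. Markov incremental gradient descent (MIGD) starts from an arbitrary fixed $x(1)\in X$ and iterates $$x(t+1)=\operatorname*{argmin}_{x\in X}\Big\{\langle \mathsf G(x(t);\xi_t),x\rangle+\frac1{\alpha(t)}D(x,x(t))\Big\},\qquad \alpha(t)=\frac{\alpha}{\sqrt t},\quad\alpha>0 .$$ Put $\hat x(T)=\frac1T\sum_{t=1}^Tx(t)$, and let $\lambda_2$ be the second largest eigenvalue of the symmetric matrix $\mathbb E[P(1)^\top P(1)]$. Assume $\lambda_2<1$. **Corollary 5.** There is a universal constant $0<C\le4$ such that, in every such setting and for all integers $T\ge1$ and all $\delta\in(0,1]$, with probability at least $1-\delta$ the following holds simultaneously for all $x^\star\in X$ and all $\epsilon\in(0,nT/\delta)$: $$f(\hat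 x(T))-f(x^\star)\le C\left(\frac{R^2}{\alpha\sqrt T}+\frac{\log\frac n\epsilon+\log\frac T\delta}{1-\lambda_2}\cdot\frac{G^2\alpha}{\sqrt T}+\epsilon GR+\frac{GR}{\sqrt T}\sqrt{\frac{\log\frac{Tn}{\epsilon\delta}\;\log\!\Big(\frac1\delta\log\frac{Tn}{\epsilon\delta}\big/(1-\lambda_2)\Big)}{1-\lambda_2}}\,\right),$$ where the square root of a negative number is read as $0$. -/

import Mathlib

open MeasureTheory ProbabilityTheory

open scoped Matrix

noncomputable section

namespace RandomMIGD

/-- The Bregman divergence of `ψ` over `X`,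
`D(x, y) = ψ(x) - ψ(y) - ⟨∇ψ(y), x - y⟩`.  For convex `X` and `x, y ∈ X` the last term is the
derivative of `ψ` at `y` along the segment to `x`, so it does not depend on how `ψ` is extended
outside of `X`. -/
def bregman {E : Type*} [NormedAddCommGroup E] [NormedSpace ℝ E]
    (ψ : E → ℝ) (X : Set E) (x y : E) : ℝ :=
  ψ x - ψ y - fderivWithin ℝ ψ X y (x - y)

/-- `x'` is the mirror descent update
`argmin_{y ∈ X} { ⟨g, y⟩ + (1 / a) D(y, x) }`. -/
def IsMirrorStep {E : Type*} [NormedAddCommGroup E] [NormedSpace ℝ E]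
    (ψ : E → ℝ) (X : Set E) (a : ℝ) (g : E →L[ℝ] ℝ) (x x' : E) : Prop :=
  x' ∈ X ∧ IsMinOn (fun y => g y + (1 / a) * bregman ψ X y x) X x'

/-- `g` is a subgradient at `x` of the convex function `h` on `X`. -/
def IsSubgradientOn {E : Type*} [NormedAddCommGroup E] [NormedSpace ℝ E]
    (h : E → ℝ) (X : Set E) (x : E) (g : E →L[ℝ] ℝ) : Prop :=
  ∀ y ∈ X, h x + g (y - x) ≤ h y

/-- The objective `f(x) = (1/n) ∑ᵢ fᵢ(x)` with `fᵢ(x) = 𝔼_{Πᵢ}[F(x; ·)]`. -/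
def objective {n : ℕ} {E Ξ : Type*} [MeasurableSpace Ξ]
    (F : E → Ξ → ℝ) (loc : Fin n → Measure Ξ) (x : E) : ℝ :=
  (1 / (n : ℝ)) * ∑ i, ∫ z, F x z ∂(loc i)

/-- The average `(1/T) ∑_{t=1}^T x(t)`. -/
def average {E : Type*} [NormedAddCommGroup E] [NormedSpace ℝ E] (x : ℕ → E) (T : ℕ) : E :=
  (1 / (T : ℝ)) • ∑ t ∈ Finset.Icc 1 T, x t

section Sampling

variable {Ω Ξ : Type*} {n : ℕ}

/-- The σ-algebra generated by a random matrix, that is, by its entries. -/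
abbrev matrixSigma (Q : Ω → Matrix (Fin n) (Fin n) ℝ) : MeasurableSpace Ω :=
  ⨆ i, ⨆ j, MeasurableSpace.comap (fun ω => Q ω i j) inferInstance

/-- The σ-algebra of everything that has happened up to and including time `t`: the tokens
`i(0), …, i(t)`, the matrices `P(1), …, P(t)` and the samples `ξ(1), …, ξ(t)`. -/
abbrev history [MeasurableSpace Ξ] (P : ℕ → Ω → Matrix (Fin n) (Fin n) ℝ)
    (token : ℕ → Ω → Fin n) (ξ : ℕ → Ω → Ξ) (t : ℕ) : MeasurableSpace Ω :=
  (⨆ s ∈ Finset.Icc 0 t, MeasurableSpace.comap (token s) ⊤) ⊔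
    ⨆ s ∈ Finset.Icc 1 t, (matrixSigma (P s) ⊔ MeasurableSpace.comap (ξ s) inferInstance)

/-- The sampling mechanism of Markov incremental gradient descent with random transition
matrices.  The matrices `P(1), P(2), …` are i.i.d. and doubly stochastic, `P(t + 1)` being drawn
independently of everything that happened up to time `t`.  The token starts at an arbitrary
`i(0)`; given the history up to time `t` and `P(t + 1)` it moves from `i(t)` to `j` with
probability `P(t + 1)_{i(t), j}`.  Given all this and `i(t + 1)`, the processor `i(t + 1)` draws
the sample `ξ(t + 1)` from its local distribution. -/
structure IsRandomMIGDSampling [MeasurableSpace Ω] [MeasurableSpace Ξ] (μ : Measure Ω)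
    (loc : Fin n → Measure Ξ) (P : ℕ → Ω → Matrix (Fin n) (Fin n) ℝ)
    (token : ℕ → Ω → Fin n) (ξ : ℕ → Ω → Ξ) : Prop where
  measurable_matrix : ∀ t, 1 ≤ t → ∀ i j, Measurable fun ω => P t ω i j
  measurable_token : ∀ t, Measurable (token t)
  measurable_sample : ∀ t, 1 ≤ t → Measurable (ξ t)
  doublyStochastic : ∀ t, 1 ≤ t → ∀ᵐ ω ∂μ, P t ω ∈ _root_.doublyStochastic ℝ (Fin n)
  identDistrib : ∀ t, 1 ≤ t →
    IdentDistrib (fun ω (i j : Fin n) => P t ω i j) (fun ω (i j : Fin n) => P 1 ω i j) μ μ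
  indep : ∀ t, Indep (matrixSigma (P (t + 1))) (history P token ξ t) μ
  token_law : ∀ t (j : Fin n),
    μ[(token (t + 1) ⁻¹' {j}).indicator (fun _ => (1 : ℝ)) |
        history P token ξ t ⊔ matrixSigma (P (t + 1))]
      =ᵐ[μ] fun ω => P (t + 1) ω (token t ω) j
  sample_law : ∀ t (A : Set Ξ), MeasurableSet A →
    μ[(ξ (t + 1) ⁻¹' A).indicator (fun _ => (1 : ℝ)) |
        history P token ξ t ⊔ matrixSigma (P (t + 1)) ⊔
          MeasurableSpace.comap (token (t + 1)) ⊤]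
      =ᵐ[μ] fun ω => (loc (token (t + 1) ω)).real A

/-- The matrix `𝔼[Qᵀ Q]` of a random matrix `Q`. -/
def expectedGram [MeasurableSpace Ω] (μ : Measure Ω) (Q : Ω → Matrix (Fin n) (Fin n) ℝ) :
    Matrix (Fin n) (Fin n) ℝ :=
  Matrix.of fun i j => ∫ ω, ((Q ω)ᵀ * Q ω) i j ∂μ

theorem expectedGram_isHermitian [MeasurableSpace Ω] (μ : Measure Ω)
    (Q : Ω → Matrix (Fin n) (Fin n) ℝ) : (expectedGram μ Q).IsHermitian := by
  ext i j
  simp only [expectedGram, Matrix.conjTranspose_apply, Matrix.of_apply, star_trivial,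
    Matrix.mul_apply, Matrix.transpose_apply, mul_comm]

end Sampling

/-- The second largest eigenvalue (with multiplicity) of a real symmetric `n × n` matrix,
`n ≥ 2`; `eigenvalues₀` lists the eigenvalues in decreasing order, starting from index `0`. -/
def secondEigenvalue {n : ℕ} (hn : 2 ≤ n) (A : Matrix (Fin n) (Fin n) ℝ)
    (hA : A.IsHermitian) : ℝ :=
  hA.eigenvalues₀ ⟨1, by rw [Fintype.card_fin]; omega⟩

/-- `λ₂(𝔼[Qᵀ Q])`. -/
def lambdaTwo {Ω : Type*} [MeasurableSpace Ω] {n : ℕ} (hn : 2 ≤ n) (μ : Measure Ω)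
    (Q : Ω → Matrix (Fin n) (Fin n) ℝ) : ℝ :=
  secondEigenvalue hn (expectedGram μ Q) (expectedGram_isHermitian μ Q)

end RandomMIGD

end

/-!
The token forgets its position geometrically: conditionally on the history up to time `t`, the law
of `i(t + p)` is row `i(t)` of `𝔼[P(1)] ^ p`, whose ℓ²-distance to the uniform law is at most
`λ₂ ^ (p / 2)`. Hence the sample `ξ(t + p)` is, up to a bias `√(n λ₂ ^ p) G R`, a fresh sample
of the gap `F(x(t); ·) - F(x⋆; ·)`, evaluated at the iterate of `p` steps earlier. Splitting the
times into `p` residue classes turns the sums of gaps minus their conditional expectations into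
`p` martingales, to which Azuma's inequality applies; the sum of the delayed gaps is bounded
pathwise by the regret of mirror descent plus the drift of the iterates over `p` steps. Choosing
`p` of the order of `(log (n / ε) + log (T / δ)) / (1 - λ₂)` balances the terms. If this is too
large for the horizon, or if `ε` is not small, the bound already exceeds the diameter bound `G R`.

The resulting event depends on `x⋆` and `ε` only through the level of the single random variable
`f(x̂(T))`, so the events are nested and hold simultaneously with the same probability.
-/

noncomputable section

namespace RandomMIGD

open Filter Topology

open scoped NNReal ENNReal

section MirrorDescent

variable {E : Type*} [NormedAddCommGroup E] [NormedSpace ℝ E] {X : Set E} {ψ : E → ℝ}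

theorem add_hasFDerivWithinAt_add_modulus_le {φ : ℝ → ℝ} {f : E → ℝ} {f' : E →L[ℝ] ℝ} {x y : E}
    (hf : UniformConvexOn X φ f) (hf' : HasFDerivWithinAt f f' X x) (hx : x ∈ X) (hy : y ∈ X) :
    f x + f' (y - x) + φ ‖y - x‖ ≤ f y := by
  have hmaps : Set.MapsTo (AffineMap.lineMap x y) (Set.Ioc (0 : ℝ) 1) X := fun r hr =>
    hf.1.lineMap_mem hx hy ⟨hr.1.le, hr.2⟩
  have hderiv : HasDerivWithinAt (f ∘ AffineMap.lineMap x y) (f' (y - x)) (Set.Ioc (0 : ℝ) 1) 0 :=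
    hf'.comp_hasDerivWithinAt_of_eq 0 AffineMap.hasDerivWithinAt_lineMap hmaps (by simp)
  rw [hasDerivWithinAt_iff_tendsto_slope' (by simp), nhdsWithin_Ioc_eq_nhdsGT one_pos] at hderiv
  have hbound : Tendsto (fun r : ℝ => f y - f x - (1 - r) * φ ‖y - x‖) (𝓝[>] 0)
      (𝓝 (f y - f x - (1 - 0) * φ ‖y - x‖)) :=
    (Continuous.tendsto (by fun_prop) 0).mono_left nhdsWithin_le_nhds
  suffices ∀ᶠ r : ℝ in 𝓝[>] 0, slope (f ∘ AffineMap.lineMap x y) 0 r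
      ≤ f y - f x - (1 - r) * φ ‖y - x‖ by linarith [le_of_tendsto_of_tendsto hderiv hbound this]
  filter_upwards [Ioc_mem_nhdsGT one_pos] with r hr
  have hconv := hf.2 hy hx hr.1.le (sub_nonneg.2 hr.2) (add_sub_cancel r 1)
  rw [add_comm, ← AffineMap.lineMap_apply_module] at hconv
  simp only [smul_eq_mul] at hconv
  rw [slope_def_field, sub_zero, div_le_iff₀ hr.1, Function.comp_apply, Function.comp_apply,
    AffineMap.lineMap_apply_zero]
  linarith

theorem bregman_self (x : E) : bregman ψ X x x = 0 := by
  simp [bregman]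

theorem bregman_three_point (x y z : E) :
    bregman ψ X y x - bregman ψ X y z - bregman ψ X z x
      = fderivWithin ℝ ψ X z (y - z) - fderivWithin ℝ ψ X x (y - z) := by
  have hsplit : y - x = (y - z) + (z - x) := by abel
  simp only [bregman, hsplit, map_add]
  ring

/-- A prox-function of `X`: a differentiable function which is `1`-strongly convex on `X`, and so
generates a Bregman divergence that dominates half of the squared distance. -/
structure IsProxFunction (ψ : E → ℝ) (X : Set E) : Prop where
  differentiableOn : DifferentiableOn ℝ ψ X
  strongConvexOn : StrongConvexOn X 1 ψ

namespace IsProxFunction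

theorem convex (hψ : IsProxFunction ψ X) : Convex ℝ X :=
  hψ.strongConvexOn.1

theorem half_sq_norm_le_bregman (hψ : IsProxFunction ψ X) {x y : E} (hx : x ∈ X) (hy : y ∈ X) :
    1 / 2 * ‖x - y‖ ^ 2 ≤ bregman ψ X x y := by
  have := add_hasFDerivWithinAt_add_modulus_le hψ.strongConvexOn
    (hψ.differentiableOn y hy).hasFDerivWithinAt hy hx
  unfold bregman
  linarith

theorem bregman_nonneg (hψ : IsProxFunction ψ X) {x y : E} (hx : x ∈ X) (hy : y ∈ X) :
    0 ≤ bregman ψ X x y :=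
  le_trans (by positivity) (hψ.half_sq_norm_le_bregman hx hy)

theorem norm_sub_le_of_bregman_le (hψ : IsProxFunction ψ X) {R : ℝ} (hR : 0 ≤ R) {x y : E}
    (hx : x ∈ X) (hy : y ∈ X) (hD : bregman ψ X x y ≤ 1 / 2 * R ^ 2) : ‖x - y‖ ≤ R :=
  (sq_le_sq₀ (norm_nonneg _) hR).1 (by linarith [hψ.half_sq_norm_le_bregman hx hy])

end IsProxFunction

variable {a : ℝ} {g : E →L[ℝ] ℝ} {x x' : E}

namespace IsMirrorStep

theorem mul_apply_sub_le (h : IsMirrorStep ψ X a g x x') (hψ : DifferentiableOn ℝ ψ X)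
    (hX : Convex ℝ X) (ha : 0 < a) {y : E} (hy : y ∈ X) :
    a * g (x' - y) ≤ bregman ψ X y x - bregman ψ X y x' - bregman ψ X x' x := by
  obtain ⟨hx', hmin⟩ := h
  have hderiv : HasFDerivWithinAt (fun y => g y + (1 / a) * bregman ψ X y x)
      (g + (1 / a) • (fderivWithin ℝ ψ X x' - fderivWithin ℝ ψ X x)) X x' :=
    g.hasFDerivWithinAt.add <| HasFDerivWithinAt.const_mul
      (((hψ x' hx').hasFDerivWithinAt.sub_const _).sub <|
        (fderivWithin ℝ ψ X x).hasFDerivWithinAt.comp x'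
          ((hasFDerivWithinAt_id x' X).sub_const x) (Set.mapsTo_univ _ _)) _
  have hfirst := hmin.localize.hasFDerivWithinAt_nonneg hderiv
    (sub_mem_posTangentConeAt_of_segment_subset (hX.segment_subset hx' hy))
  simp only [add_apply, smul_apply, sub_apply, smul_eq_mul, one_div] at hfirst
  have hscaled := mul_nonneg ha.le hfirst
  rw [mul_add, mul_inv_cancel_left₀ ha.ne'] at hscaled
  rw [bregman_three_point, ← neg_sub y x', map_neg]
  linarith

theorem add_half_sq_norm_le (h : IsMirrorStep ψ X a g x x') (hψ : IsProxFunction ψ X)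
    (ha : 0 < a) {y : E} (hy : y ∈ X) :
    a * g x' + bregman ψ X x' x + 1 / 2 * ‖y - x'‖ ^ 2 ≤ a * g y + bregman ψ X y x := by
  have hkey := h.mul_apply_sub_le hψ.differentiableOn hψ.convex ha hy
  rw [map_sub, mul_sub] at hkey
  linarith [hψ.half_sq_norm_le_bregman hy h.1]

theorem norm_sub_le (h : IsMirrorStep ψ X a g x x') (hψ : IsProxFunction ψ X) (ha : 0 < a)
    (hx : x ∈ X) : ‖x - x'‖ ≤ a * ‖g‖ := by
  have hkey := h.mul_apply_sub_le hψ.differentiableOn hψ.convex ha hx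
  have hforth := hψ.half_sq_norm_le_bregman hx h.1
  have hback := hψ.half_sq_norm_le_bregman h.1 hx
  rw [← neg_sub x x', map_neg, bregman_self] at hkey
  rw [norm_sub_rev] at hback
  have hdual : a * g (x - x') ≤ a * ‖g‖ * ‖x - x'‖ := by
    rw [mul_assoc]
    gcongr
    exact (le_abs_self _).trans (g.le_opNorm _)
  rcases (norm_nonneg (x - x')).eq_or_lt with h0 | h0
  · rw [← h0]; positivity
  · exact le_of_mul_le_mul_right (by linarith) h0

theorem regret_le (h : IsMirrorStep ψ X a g x x') (hψ : IsProxFunction ψ X) (ha : 0 < a)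
    (hx : x ∈ X) {y : E} (hy : y ∈ X) :
    g (x - y) ≤ 1 / a * (bregman ψ X y x - bregman ψ X y x') + a / 2 * ‖g‖ ^ 2 := by
  have hkey := h.mul_apply_sub_le hψ.differentiableOn hψ.convex ha hy
  have hback := hψ.half_sq_norm_le_bregman h.1 hx
  have hsplit : g (x - y) = g (x - x') + g (x' - y) := by rw [← map_add]; congr 1; abel
  have hdual : a * g (x - x') ≤ a * ‖g‖ * ‖x' - x‖ := by
    rw [mul_assoc, norm_sub_rev]
    gcongr
    exact (le_abs_self _).trans (g.le_opNorm _)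
  have hscaled : a * g (x - y)
      ≤ bregman ψ X y x - bregman ψ X y x' + a ^ 2 / 2 * ‖g‖ ^ 2 := by
    rw [hsplit]
    linarith [sq_nonneg (a * ‖g‖ - ‖x' - x‖)]
  refine le_of_mul_le_mul_left (hscaled.trans_eq ?_) ha
  field_simp

end IsMirrorStep

theorem sum_range_inv_sqrt_le (N : ℕ) : ∑ s ∈ Finset.range N, 1 / √((s : ℝ) + 1) ≤ 2 * √N := by
  induction N with
  | zero => simp
  | succ N ih =>
    have hpos : 0 < √((N : ℝ) + 1) := by positivity
    have hsq : √(N : ℝ) ^ 2 = N := Real.sq_sqrt (by positivity)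
    have hsq' : √((N : ℝ) + 1) ^ 2 = N + 1 := Real.sq_sqrt (by positivity)
    have hterm : 1 / √((N : ℝ) + 1) ≤ 2 * (√((N : ℝ) + 1) - √N) := by
      rw [div_le_iff₀ hpos]
      linarith [sq_nonneg (√((N : ℝ) + 1) - √N)]
    rw [Finset.sum_range_succ, Nat.cast_succ]
    linarith

theorem sum_range_mul_sub_succ_le {w D : ℕ → ℝ} {B : ℝ} (hw : Monotone w) (hw0 : 0 ≤ w 0)
    (hD0 : ∀ s, 0 ≤ D s) (hDB : ∀ s, D s ≤ B) (N : ℕ) :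
    ∑ s ∈ Finset.range N, w (s + 1) * (D s - D (s + 1)) ≤ w N * B := by
  suffices ∑ s ∈ Finset.range N, w (s + 1) * (D s - D (s + 1)) + w N * D N ≤ w N * B by
    linarith [mul_nonneg (hw0.trans (hw N.zero_le)) (hD0 N)]
  induction N with
  | zero => simpa using mul_le_mul_of_nonneg_left (hDB 0) hw0
  | succ N ih =>
    rw [Finset.sum_range_succ]
    linarith [mul_le_mul_of_nonneg_left (hDB N) (sub_nonneg.2 (hw N.le_succ))]

/-- A run of mirror descent on `X` with prox-function `ψ`, step sizes `a / √t` and gradients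
`g t`.  As in the paper, time starts at `t = 1`; `x 0` and `g 0` are irrelevant. -/
structure IsMirrorDescent (ψ : E → ℝ) (X : Set E) (a : ℝ) (g : ℕ → E →L[ℝ] ℝ) (x : ℕ → E) :
    Prop where
  start_mem : x 1 ∈ X
  step : ∀ t : ℕ, 1 ≤ t → IsMirrorStep ψ X (a / √(t : ℝ)) (g t) (x t) (x (t + 1))

namespace IsMirrorDescent

variable {R G : ℝ} {g : ℕ → E →L[ℝ] ℝ} {x : ℕ → E}

theorem mem (h : IsMirrorDescent ψ X a g x) {t : ℕ} (ht : 1 ≤ t) : x t ∈ X := by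
  obtain _ | _ | t := t
  · omega
  · exact h.start_mem
  · exact (h.step (t + 1) (by omega)).1

theorem sum_regret_le (h : IsMirrorDescent ψ X a g x) (hψ : IsProxFunction ψ X)
    (hD : ∀ x ∈ X, ∀ y ∈ X, bregman ψ X x y ≤ 1 / 2 * R ^ 2) (ha : 0 < a)
    (hg : ∀ t, 1 ≤ t → ‖g t‖ ≤ G) {y : E} (hy : y ∈ X) (d N : ℕ) :
    ∑ s ∈ Finset.range N, g (s + d + 1) (x (s + d + 1) - y)
      ≤ √((N + d : ℕ) : ℝ) / a * (1 / 2 * R ^ 2) + a * G ^ 2 * √N := by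
  have hterm (s : ℕ) : g (s + d + 1) (x (s + d + 1) - y)
      ≤ √((s + 1 + d : ℕ) : ℝ) / a
          * (bregman ψ X y (x (s + d + 1)) - bregman ψ X y (x (s + 1 + d + 1)))
        + a * G ^ 2 / 2 * (1 / √((s : ℝ) + 1)) := by
    have hstep := (h.step (s + d + 1) (by omega)).regret_le hψ (by positivity)
      (h.mem (by omega)) hy
    rw [one_div_div] at hstep
    rw [show s + 1 + d = s + d + 1 by omega]
    refine hstep.trans (add_le_add_right ?_ _)
    calc a / √((s + d + 1 : ℕ) : ℝ) / 2 * ‖g (s + d + 1)‖ ^ 2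
        ≤ a / √((s : ℝ) + 1) / 2 * G ^ 2 := by
          gcongr
          · push_cast; linarith [(Nat.cast_nonneg d : (0 : ℝ) ≤ d)]
          · exact hg _ (by omega)
      _ = _ := by ring
  have habel := sum_range_mul_sub_succ_le (w := fun s => √((s + d : ℕ) : ℝ) / a)
    (D := fun s => bregman ψ X y (x (s + d + 1)))
    (fun s t hst => by dsimp only; gcongr) (by positivity)
    (fun s => hψ.bregman_nonneg hy (h.mem (by omega)))
    (fun s => hD y hy _ (h.mem (by omega))) N
  have hsqrt := mul_le_mul_of_nonneg_left (sum_range_inv_sqrt_le N)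
    (by positivity : 0 ≤ a * G ^ 2 / 2)
  have hsum := Finset.sum_le_sum fun s (_ : s ∈ Finset.range N) => hterm s
  rw [Finset.sum_add_distrib, ← Finset.mul_sum] at hsum
  linarith

theorem norm_sub_add_le (h : IsMirrorDescent ψ X a g x) (hψ : IsProxFunction ψ X) (ha : 0 < a)
    (hg : ∀ t, 1 ≤ t → ‖g t‖ ≤ G) (s d : ℕ) :
    ‖x (s + 1) - x (s + d + 1)‖ ≤ d * (a * G * (1 / √((s : ℝ) + 1))) := by
  induction d with
  | zero => simp
  | succ d ih =>
    have hstep : ‖x (s + d + 1) - x (s + (d + 1) + 1)‖ ≤ a * G * (1 / √((s : ℝ) + 1)) :=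
      calc _ ≤ a / √((s + d + 1 : ℕ) : ℝ) * ‖g (s + d + 1)‖ :=
            (h.step (s + d + 1) (by omega)).norm_sub_le hψ (by positivity) (h.mem (by omega))
        _ ≤ a / √((s : ℝ) + 1) * G := by
            gcongr
            · push_cast; linarith [(Nat.cast_nonneg d : (0 : ℝ) ≤ d)]
            · exact hg _ (by omega)
        _ = _ := by ring
    calc _ ≤ ‖x (s + 1) - x (s + d + 1)‖ + ‖x (s + d + 1) - x (s + (d + 1) + 1)‖ :=
          norm_sub_le_norm_sub_add_norm_sub _ _ _
      _ ≤ d * (a * G * (1 / √((s : ℝ) + 1))) + a * G * (1 / √((s : ℝ) + 1)) := add_le_add ih hstep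
      _ = _ := by push_cast; ring

theorem sum_delayed_loss_le (h : IsMirrorDescent ψ X a g x) (hψ : IsProxFunction ψ X)
    (hD : ∀ x ∈ X, ∀ y ∈ X, bregman ψ X x y ≤ 1 / 2 * R ^ 2) (ha : 0 < a) (hG : 0 ≤ G)
    (hg : ∀ t, 1 ≤ t → ‖g t‖ ≤ G) {φ : ℕ → E → ℝ}
    (hφ : ∀ t, 1 ≤ t → ∀ y ∈ X, ∀ y' ∈ X, |φ t y - φ t y'| ≤ G * ‖y - y'‖)
    (hsub : ∀ t, 1 ≤ t → IsSubgradientOn (φ t) X (x t) (g t)) {y : E} (hy : y ∈ X) (d N : ℕ) :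
    ∑ s ∈ Finset.range N, (φ (s + d + 1) (x (s + 1)) - φ (s + d + 1) y)
      ≤ (2 * d + 1) * (a * G ^ 2 * √N) + √((N + d : ℕ) : ℝ) / a * (1 / 2 * R ^ 2) := by
  have hterm (s : ℕ) : φ (s + d + 1) (x (s + 1)) - φ (s + d + 1) y
      ≤ d * (a * G ^ 2) * (1 / √((s : ℝ) + 1)) + g (s + d + 1) (x (s + d + 1) - y) := by
    have hdrift := mul_le_mul_of_nonneg_left (h.norm_sub_add_le hψ ha hg s d) hG
    have hlip := (abs_le.1 (hφ (s + d + 1) (by omega) _ (h.mem (t := s + 1) (by omega)) _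
      (h.mem (t := s + d + 1) (by omega)))).2
    have hconv := hsub (s + d + 1) (by omega) y hy
    rw [← neg_sub, map_neg] at hconv
    linarith
  have hregret := h.sum_regret_le hψ hD ha hg hy d N
  have hsqrt := mul_le_mul_of_nonneg_left (sum_range_inv_sqrt_le N)
    (by positivity : 0 ≤ (d : ℝ) * (a * G ^ 2))
  have hsum := Finset.sum_le_sum fun s (_ : s ∈ Finset.range N) => hterm s
  rw [Finset.sum_add_distrib, ← Finset.mul_sum] at hsum
  linarith

end IsMirrorDescent

end MirrorDescent

section Spectral

variable {ι : Type*} [Fintype ι]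

theorem sum_dotProduct_mul_dotProduct (b : OrthonormalBasis ι ℝ (EuclideanSpace ℝ ι))
    (u v : ι → ℝ) : ∑ i, (⇑(b i) ⬝ᵥ u) * (⇑(b i) ⬝ᵥ v) = u ⬝ᵥ v := by
  have hparseval := b.sum_inner_mul_inner (WithLp.toLp 2 u) (WithLp.toLp 2 v)
  simp only [EuclideanSpace.inner_eq_star_dotProduct, star_trivial] at hparseval
  simp only [dotProduct_comm u v, ← hparseval, dotProduct_comm v]

variable [DecidableEq ι] {A : Matrix ι ι ℝ}

theorem eigenvectorBasis_dotProduct_mulVec (hA : A.IsHermitian) (i : ι) (v : ι → ℝ) :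
    ⇑(hA.eigenvectorBasis i) ⬝ᵥ A *ᵥ v = hA.eigenvalues i * (⇑(hA.eigenvectorBasis i) ⬝ᵥ v) := by
  have hsymm : Aᵀ = A := by simpa [Matrix.IsHermitian] using hA
  rw [Matrix.dotProduct_mulVec, ← Matrix.mulVec_transpose, hsymm, hA.mulVec_eigenvectorBasis,
    smul_dotProduct, smul_eq_mul]

theorem eigenvectorBasis_dotProduct_eq_zero (hA : A.IsHermitian) {u : ι → ℝ} {c : ℝ}
    (hu : A *ᵥ u = c • u) {i : ι} (hi : hA.eigenvalues i ≠ c) :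
    ⇑(hA.eigenvectorBasis i) ⬝ᵥ u = 0 := by
  have heig := eigenvectorBasis_dotProduct_mulVec hA i u
  rw [hu, dotProduct_smul, smul_eq_mul] at heig
  exact (mul_eq_mul_right_iff.1 heig).resolve_left (Ne.symm hi)

theorem dotProduct_mulVec_le_of_eigenvalues_le (hA : A.IsHermitian) {i₀ : ι} {r : ℝ}
    (hr : ∀ i, i ≠ i₀ → hA.eigenvalues i ≤ r) {v : ι → ℝ}
    (hv : ⇑(hA.eigenvectorBasis i₀) ⬝ᵥ v = 0) : v ⬝ᵥ A *ᵥ v ≤ r * (v ⬝ᵥ v) := by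
  rw [← sum_dotProduct_mul_dotProduct hA.eigenvectorBasis v (A *ᵥ v),
    ← sum_dotProduct_mul_dotProduct hA.eigenvectorBasis v v, Finset.mul_sum]
  refine Finset.sum_le_sum fun i _ => ?_
  rw [eigenvectorBasis_dotProduct_mulVec, mul_left_comm]
  by_cases hi : i = i₀
  · simp [hi, hv]
  · exact mul_le_mul_of_nonneg_right (hr i hi) (mul_self_nonneg _)

theorem dotProduct_mulVec_le_of_mulVec_eq_smul (hA : A.IsHermitian) {i₀ : ι} {r c : ℝ}
    (hr : ∀ i, i ≠ i₀ → hA.eigenvalues i ≤ r) (hrc : r < c) {u v : ι → ℝ} (hu0 : u ≠ 0)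
    (hu : A *ᵥ u = c • u) (huv : u ⬝ᵥ v = 0) : v ⬝ᵥ A *ᵥ v ≤ r * (v ⬝ᵥ v) := by
  have hexpand (w : ι → ℝ) : u ⬝ᵥ w
      = (⇑(hA.eigenvectorBasis i₀) ⬝ᵥ u) * (⇑(hA.eigenvectorBasis i₀) ⬝ᵥ w) := by
    rw [← sum_dotProduct_mul_dotProduct hA.eigenvectorBasis u w]
    refine Finset.sum_eq_single i₀ (fun i _ hi => ?_) (by simp)
    rw [eigenvectorBasis_dotProduct_eq_zero hA hu ((hr i hi).trans_lt hrc).ne, zero_mul]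
  refine dotProduct_mulVec_le_of_eigenvalues_le hA hr ?_
  rw [hexpand v] at huv
  refine (mul_eq_zero.1 huv).resolve_left fun h0 => hu0 (dotProduct_self_eq_zero.1 ?_)
  rw [hexpand u, h0, zero_mul]

theorem exists_forall_eigenvalues_le_secondEigenvalue {n : ℕ} (hn : 2 ≤ n)
    {A : Matrix (Fin n) (Fin n) ℝ} (hA : A.IsHermitian) :
    ∃ i₀, ∀ i, i ≠ i₀ → hA.eigenvalues i ≤ secondEigenvalue hn A hA := by
  refine ⟨Fintype.equivOfCardEq (Fintype.card_fin _) ⟨0, by rw [Fintype.card_fin]; omega⟩,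
    fun i hi => hA.eigenvalues₀_antitone ?_⟩
  rw [ne_eq, ← Equiv.symm_apply_eq, Fin.ext_iff] at hi
  exact Fin.le_def.2 (Nat.one_le_iff_ne_zero.2 hi)

theorem dotProduct_mulVec_le_secondEigenvalue {n : ℕ} (hn : 2 ≤ n)
    {A : Matrix (Fin n) (Fin n) ℝ} (hA : A.IsHermitian) {c : ℝ}
    (hc : secondEigenvalue hn A hA < c) {u v : Fin n → ℝ} (hu0 : u ≠ 0) (hu : A *ᵥ u = c • u)
    (huv : u ⬝ᵥ v = 0) : v ⬝ᵥ A *ᵥ v ≤ secondEigenvalue hn A hA * (v ⬝ᵥ v) := by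
  obtain ⟨i₀, hi₀⟩ := exists_forall_eigenvalues_le_secondEigenvalue hn hA
  exact dotProduct_mulVec_le_of_mulVec_eq_smul hA hi₀ hc hu0 hu huv

theorem secondEigenvalue_nonneg {n : ℕ} (hn : 2 ≤ n) {A : Matrix (Fin n) (Fin n) ℝ}
    (hA : A.PosSemidef) : 0 ≤ secondEigenvalue hn A hA.isHermitian := by
  have h := hA.eigenvalues_nonneg (Fintype.equivOfCardEq (Fintype.card_fin _)
    ⟨1, by rw [Fintype.card_fin]; omega⟩)
  simpa [Matrix.IsHermitian.eigenvalues] using! h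

end Spectral

section RandomMatrix

variable {ι : Type*} [Fintype ι] {Ω : Type*} [MeasurableSpace Ω] {μ : Measure Ω}

/-- The mean `𝔼[Q]` of a random matrix `Q`. -/
def meanMatrix (μ : Measure Ω) (Q : Ω → Matrix ι ι ℝ) : Matrix ι ι ℝ :=
  Matrix.of fun i j => ∫ ω, Q ω i j ∂μ

theorem meanMatrix_mulVec_apply {Q : Ω → Matrix ι ι ℝ}
    (hQ : ∀ i j, Integrable (fun ω => Q ω i j) μ) (v : ι → ℝ) (i : ι) :
    (meanMatrix μ Q *ᵥ v) i = ∫ ω, (Q ω *ᵥ v) i ∂μ := by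
  simp only [Matrix.mulVec, dotProduct, meanMatrix, Matrix.of_apply]
  rw [integral_finsetSum _ fun j _ => (hQ i j).mul_const _]
  simp only [integral_mul_const]

variable [DecidableEq ι]

theorem memLp_of_ae_mem_doublyStochastic [IsFiniteMeasure μ] {Q : Ω → Matrix ι ι ℝ}
    (hQ : ∀ i j, Measurable fun ω => Q ω i j) (hds : ∀ᵐ ω ∂μ, Q ω ∈ doublyStochastic ℝ ι)
    (p : ℝ≥0∞) (i j : ι) : MemLp (fun ω => Q ω i j) p μ := by
  refine MemLp.of_bound (hQ i j).aestronglyMeasurable 1 ?_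
  filter_upwards [hds] with ω hω
  rw [Real.norm_of_nonneg (nonneg_of_mem_doublyStochastic hω)]
  exact le_one_of_mem_doublyStochastic hω

theorem integrable_of_ae_mem_doublyStochastic [IsFiniteMeasure μ] {Q : Ω → Matrix ι ι ℝ}
    (hQ : ∀ i j, Measurable fun ω => Q ω i j) (hds : ∀ᵐ ω ∂μ, Q ω ∈ doublyStochastic ℝ ι)
    (i j : ι) : Integrable (fun ω => Q ω i j) μ :=
  memLp_one_iff_integrable.1 (memLp_of_ae_mem_doublyStochastic hQ hds 1 i j)

theorem meanMatrix_mem_doublyStochastic [IsProbabilityMeasure μ] {Q : Ω → Matrix ι ι ℝ}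
    (hQ : ∀ i j, Measurable fun ω => Q ω i j) (hds : ∀ᵐ ω ∂μ, Q ω ∈ doublyStochastic ℝ ι) :
    meanMatrix μ Q ∈ doublyStochastic ℝ ι := by
  have hint := integrable_of_ae_mem_doublyStochastic hQ hds
  refine mem_doublyStochastic_iff_sum.2 ⟨fun i j => integral_nonneg_of_ae ?_, fun i => ?_,
    fun j => ?_⟩
  · filter_upwards [hds] with ω hω using nonneg_of_mem_doublyStochastic hω
  · have hrow : (fun ω => ∑ j, Q ω i j) =ᵐ[μ] fun _ => 1 := by
      filter_upwards [hds] with ω hω using sum_row_of_mem_doublyStochastic hω i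
    simp [meanMatrix, ← integral_finsetSum _ fun j _ => hint i j, integral_congr_ae hrow]
  · have hcol : (fun ω => ∑ i, Q ω i j) =ᵐ[μ] fun _ => 1 := by
      filter_upwards [hds] with ω hω using sum_col_of_mem_doublyStochastic hω j
    simp [meanMatrix, ← integral_finsetSum _ fun i _ => hint i j, integral_congr_ae hcol]

end RandomMatrix

theorem sum_sub_mean {n : ℕ} [NeZero n] (v : Fin n → ℝ) :
    ∑ i, (v - (1 / (n : ℝ) * ∑ j, v j) • 1) i = 0 := by
  have : (n : ℝ) ≠ 0 := NeZero.ne _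
  simp only [Pi.sub_apply, Pi.smul_apply, Pi.one_apply, Finset.sum_sub_distrib, Finset.sum_const,
    Finset.card_fin, smul_eq_mul, nsmul_eq_mul]
  field_simp
  ring

theorem sub_mean_dotProduct_self_le {n : ℕ} [NeZero n] (v : Fin n → ℝ) :
    (v - (1 / (n : ℝ) * ∑ j, v j) • 1) ⬝ᵥ (v - (1 / (n : ℝ) * ∑ j, v j) • 1) ≤ v ⬝ᵥ v := by
  have hpyth : v ⬝ᵥ v = (v - (1 / (n : ℝ) * ∑ j, v j) • 1) ⬝ᵥ (v - (1 / (n : ℝ) * ∑ j, v j) • 1)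
      + 1 / (n : ℝ) * (∑ j, v j) ^ 2 := by
    simp only [sub_dotProduct, dotProduct_sub, smul_dotProduct, dotProduct_smul, dotProduct_one,
      one_dotProduct, sum_sub_mean, smul_eq_mul]
    ring
  rw [hpyth]
  exact le_add_of_nonneg_right (by positivity)

section ExpectedGram

variable {n : ℕ} {Ω : Type*} [MeasurableSpace Ω] {μ : Measure Ω} {Q : Ω → Matrix (Fin n) (Fin n) ℝ}

theorem memLp_mulVec_apply {p : ℝ≥0∞} (hQ : ∀ i j, MemLp (fun ω => Q ω i j) p μ)
    (v : Fin n → ℝ) (i : Fin n) : MemLp (fun ω => (Q ω *ᵥ v) i) p μ := by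
  simp only [Matrix.mulVec, dotProduct]
  exact memLp_finsetSum _ fun j _ => (hQ i j).mul_const (v j)

theorem integrable_gram_apply (hQ : ∀ i j, MemLp (fun ω => Q ω i j) 2 μ) (i j : Fin n) :
    Integrable (fun ω => ((Q ω)ᵀ * Q ω) i j) μ := by
  simp only [Matrix.mul_apply, Matrix.transpose_apply]
  exact integrable_finsetSum _ fun k _ => (hQ k i).integrable_mul (hQ k j)

theorem expectedGram_mulVec_apply (hQ : ∀ i j, MemLp (fun ω => Q ω i j) 2 μ) (v : Fin n → ℝ)
    (i : Fin n) : (expectedGram μ Q *ᵥ v) i = ∫ ω, (((Q ω)ᵀ * Q ω) *ᵥ v) i ∂μ :=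
  meanMatrix_mulVec_apply (Q := fun ω => (Q ω)ᵀ * Q ω) (integrable_gram_apply hQ) v i

theorem dotProduct_expectedGram_mulVec (hQ : ∀ i j, MemLp (fun ω => Q ω i j) 2 μ)
    (v : Fin n → ℝ) : v ⬝ᵥ expectedGram μ Q *ᵥ v = ∑ i, ∫ ω, (Q ω *ᵥ v) i ^ 2 ∂μ := by
  have hint (i : Fin n) : Integrable (fun ω => (((Q ω)ᵀ * Q ω) *ᵥ v) i) μ := by
    simp only [Matrix.mulVec, dotProduct]
    exact integrable_finsetSum _ fun j _ => (integrable_gram_apply hQ i j).mul_const (v j)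
  have hquad (ω : Ω) : ∑ i, v i * (((Q ω)ᵀ * Q ω) *ᵥ v) i = ∑ i, (Q ω *ᵥ v) i ^ 2 := by
    change v ⬝ᵥ ((Q ω)ᵀ * Q ω) *ᵥ v = _
    rw [← Matrix.mulVec_mulVec, Matrix.dotProduct_mulVec, Matrix.vecMul_transpose]
    simp only [dotProduct, sq]
  simp only [dotProduct, expectedGram_mulVec_apply hQ, ← integral_const_mul]
  rw [← integral_finsetSum _ fun i _ => (hint i).const_mul _,
    ← integral_finsetSum _ fun i _ => (memLp_mulVec_apply hQ v i).integrable_sq]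
  simp only [hquad]

theorem expectedGram_posSemidef (hQ : ∀ i j, MemLp (fun ω => Q ω i j) 2 μ) :
    (expectedGram μ Q).PosSemidef := by
  refine Matrix.PosSemidef.of_dotProduct_mulVec_nonneg (expectedGram_isHermitian μ Q) fun v => ?_
  rw [star_trivial, dotProduct_expectedGram_mulVec hQ]
  exact Finset.sum_nonneg fun i _ => integral_nonneg fun ω => sq_nonneg _

theorem lambdaTwo_nonneg (hn : 2 ≤ n) (hQ : ∀ i j, MemLp (fun ω => Q ω i j) 2 μ) :
    0 ≤ lambdaTwo hn μ Q :=
  secondEigenvalue_nonneg hn (expectedGram_posSemidef hQ)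

variable [IsProbabilityMeasure μ]

theorem meanMatrix_mulVec_dotProduct_self_le (hQ : ∀ i j, MemLp (fun ω => Q ω i j) 2 μ)
    (v : Fin n → ℝ) :
    (meanMatrix μ Q *ᵥ v) ⬝ᵥ (meanMatrix μ Q *ᵥ v) ≤ v ⬝ᵥ expectedGram μ Q *ᵥ v := by
  rw [dotProduct_expectedGram_mulVec hQ]
  refine Finset.sum_le_sum fun i _ => ?_
  rw [meanMatrix_mulVec_apply (fun i j => (hQ i j).integrable one_le_two), ← sq]
  have hvar := variance_nonneg (fun ω => (Q ω *ᵥ v) i) μ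
  rw [variance_eq_sub (memLp_mulVec_apply hQ v i)] at hvar
  simpa using hvar

theorem expectedGram_mulVec_one (hQ : ∀ i j, Measurable fun ω => Q ω i j)
    (hds : ∀ᵐ ω ∂μ, Q ω ∈ doublyStochastic ℝ (Fin n)) : expectedGram μ Q *ᵥ 1 = 1 := by
  ext i
  rw [expectedGram_mulVec_apply (memLp_of_ae_mem_doublyStochastic hQ hds 2)]
  have hone : (fun ω => (((Q ω)ᵀ * Q ω) *ᵥ 1) i) =ᵐ[μ] fun _ => 1 := by
    filter_upwards [hds] with ω hω
    rw [mulVec_one_of_mem_doublyStochastic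
      (mul_mem (transpose_mem_doublyStochastic_iff.2 hω) hω), Pi.one_apply]
  simp [integral_congr_ae hone]

theorem meanMatrix_pow_mulVec_dotProduct_self_le (hn : 2 ≤ n)
    (hQ : ∀ i j, Measurable fun ω => Q ω i j) (hds : ∀ᵐ ω ∂μ, Q ω ∈ doublyStochastic ℝ (Fin n))
    (hlt : lambdaTwo hn μ Q < 1) {v : Fin n → ℝ} (hv : ∑ i, v i = 0) (k : ℕ) :
    (meanMatrix μ Q ^ k *ᵥ v) ⬝ᵥ (meanMatrix μ Q ^ k *ᵥ v) ≤ lambdaTwo hn μ Q ^ k * (v ⬝ᵥ v) := by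
  have hQ2 := memLp_of_ae_mem_doublyStochastic hQ hds 2
  have : NeZero n := ⟨by omega⟩
  induction k generalizing v with
  | zero => simp
  | succ k ih =>
    have hstep : (meanMatrix μ Q *ᵥ v) ⬝ᵥ (meanMatrix μ Q *ᵥ v) ≤ lambdaTwo hn μ Q * (v ⬝ᵥ v) :=
      (meanMatrix_mulVec_dotProduct_self_le hQ2 v).trans <|
        dotProduct_mulVec_le_secondEigenvalue hn (expectedGram_isHermitian μ Q) hlt one_ne_zero
          (by rw [expectedGram_mulVec_one hQ hds, one_smul]) (by simpa [dotProduct] using hv)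
    have hv' : ∑ i, (meanMatrix μ Q *ᵥ v) i = 0 := by
      rw [sum_mulVec_of_mem_doublyStochastic (meanMatrix_mem_doublyStochastic hQ hds), hv]
    calc _ = (meanMatrix μ Q ^ k *ᵥ meanMatrix μ Q *ᵥ v)
            ⬝ᵥ (meanMatrix μ Q ^ k *ᵥ meanMatrix μ Q *ᵥ v) := by
          rw [Matrix.mulVec_mulVec, ← pow_succ]
      _ ≤ lambdaTwo hn μ Q ^ k * ((meanMatrix μ Q *ᵥ v) ⬝ᵥ (meanMatrix μ Q *ᵥ v)) := ih hv'
      _ ≤ lambdaTwo hn μ Q ^ k * (lambdaTwo hn μ Q * (v ⬝ᵥ v)) := by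
          gcongr
          exact pow_nonneg (lambdaTwo_nonneg hn hQ2) k
      _ = _ := by rw [pow_succ, mul_assoc]

theorem abs_meanMatrix_pow_mulVec_sub_mean_le (hn : 2 ≤ n)
    (hQ : ∀ i j, Measurable fun ω => Q ω i j) (hds : ∀ᵐ ω ∂μ, Q ω ∈ doublyStochastic ℝ (Fin n))
    (hlt : lambdaTwo hn μ Q < 1) {v : Fin n → ℝ} {c : ℝ} (hv : ∀ i, |v i| ≤ c) (k : ℕ)
    (i : Fin n) :
    |(meanMatrix μ Q ^ k *ᵥ v) i - 1 / (n : ℝ) * ∑ j, v j| ≤ √(n * lambdaTwo hn μ Q ^ k) * c := by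
  have : NeZero n := ⟨by omega⟩
  have hlam : 0 ≤ lambdaTwo hn μ Q ^ k :=
    pow_nonneg (lambdaTwo_nonneg hn (memLp_of_ae_mem_doublyStochastic hQ hds 2)) k
  set w : Fin n → ℝ := v - (1 / (n : ℝ) * ∑ j, v j) • 1 with hw
  have hcenter : (meanMatrix μ Q ^ k *ᵥ v) i - 1 / (n : ℝ) * ∑ j, v j
      = (meanMatrix μ Q ^ k *ᵥ w) i := by
    rw [hw, Matrix.mulVec_sub, Matrix.mulVec_smul, mulVec_one_of_mem_doublyStochastic
      (pow_mem (meanMatrix_mem_doublyStochastic hQ hds) k)]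
    simp
  have hsq : (meanMatrix μ Q ^ k *ᵥ w) i ^ 2 ≤ n * lambdaTwo hn μ Q ^ k * c ^ 2 :=
    calc (meanMatrix μ Q ^ k *ᵥ w) i ^ 2
        ≤ ∑ j, (meanMatrix μ Q ^ k *ᵥ w) j * (meanMatrix μ Q ^ k *ᵥ w) j := by
          rw [sq]
          exact Finset.single_le_sum (f := fun j => (meanMatrix μ Q ^ k *ᵥ w) j * _)
            (fun j _ => mul_self_nonneg _) (Finset.mem_univ i)
      _ ≤ lambdaTwo hn μ Q ^ k * (w ⬝ᵥ w) :=
          meanMatrix_pow_mulVec_dotProduct_self_le hn hQ hds hlt (sum_sub_mean v) k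
      _ ≤ lambdaTwo hn μ Q ^ k * (v ⬝ᵥ v) := by gcongr; exact sub_mean_dotProduct_self_le v
      _ ≤ lambdaTwo hn μ Q ^ k * ∑ _j : Fin n, c ^ 2 := by
          refine mul_le_mul_of_nonneg_left (Finset.sum_le_sum fun j _ => ?_) hlam
          rw [← sq]
          exact sq_le_sq.2 ((hv j).trans (le_abs_self c))
      _ = _ := by rw [Finset.sum_const, Finset.card_fin, nsmul_eq_mul]; ring
  rw [hcenter, ← Real.sqrt_sq ((abs_nonneg _).trans (hv i)), ← Real.sqrt_mul (by positivity)]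
  exact Real.abs_le_sqrt hsq

end ExpectedGram

section Concentration

theorem cosh_add_mul_sinh_le_exp {y : ℝ} (hy : |y| ≤ 1) (θ : ℝ) :
    Real.cosh θ + y * Real.sinh θ ≤ Real.exp (θ * y + θ ^ 2 / 2) := by
  obtain ⟨hy₁, hy₂⟩ := abs_le.1 hy
  let p : unitInterval := ⟨(1 + y) / 2, by constructor <;> linarith⟩
  have hint (f : ℝ → ℝ) :
      ∫ x, f x ∂bernoulliMeasure 1 (-1) p = (1 + y) / 2 * f 1 + (1 - y) / 2 * f (-1) := by
    rw [integral_bernoulliMeasure, smul_eq_mul, smul_eq_mul]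
    simp only [p]
    ring
  have hsupp : ∀ᵐ x ∂bernoulliMeasure (1 : ℝ) (-1) p, id x ∈ Set.Icc (-1 : ℝ) 1 :=
    bernoulliMeasure_apply_of_notMem_of_notMem p measurableSet_Icc.compl (by simp) (by simp)
  have hmean : ∫ x, id x ∂bernoulliMeasure 1 (-1) p = y := by
    rw [hint]; simp only [id]; ring
  have hmgf := (hasSubgaussianMGF_of_mem_Icc aemeasurable_id hsupp).mgf_le θ
  rw [hmean, mgf, hint] at hmgf
  have hproxy : (((‖(1 : ℝ) - -1‖₊ / 2) ^ 2 : ℝ≥0) : ℝ) = 1 := by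
    push_cast; norm_num
  calc Real.cosh θ + y * Real.sinh θ
      = Real.exp (θ * y) * ((1 + y) / 2 * Real.exp (θ * (1 - y))
          + (1 - y) / 2 * Real.exp (θ * (-1 - y))) := by
        rw [mul_sub, mul_sub, Real.exp_sub, Real.exp_sub, Real.cosh_eq, Real.sinh_eq]
        field_simp
        ring
    _ ≤ Real.exp (θ * y) * Real.exp (1 * θ ^ 2 / 2) := by
        rw [hproxy] at hmgf
        exact mul_le_mul_of_nonneg_left hmgf (Real.exp_pos _).le
    _ = Real.exp (θ * y + θ ^ 2 / 2) := by rw [← Real.exp_add, one_mul]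

theorem abs_div_self_le_one {c y : ℝ} (hy : |y| ≤ c) : |y / c| ≤ 1 := by
  rw [abs_div]
  exact div_le_one_of_le₀ (hy.trans (le_abs_self c)) (abs_nonneg c)

theorem mul_div_cancel_of_abs_le {c y : ℝ} (hy : |y| ≤ c) : c * (y / c) = y :=
  mul_div_cancel_of_imp' fun hc => abs_nonpos_iff.1 (hc ▸ hy)

theorem exp_mul_le_cosh_add_div_mul_sinh {c y : ℝ} (hy : |y| ≤ c) (θ : ℝ) :
    Real.exp (θ * y) ≤ Real.cosh (θ * c) + y / c * Real.sinh (θ * c) := by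
  have h := Real.exp_mul_le_cosh_add_mul_sinh (abs_div_self_le_one hy) (θ * c)
  rwa [mul_comm, mul_assoc, mul_div_cancel_of_abs_le hy] at h

theorem cosh_add_div_mul_sinh_le_exp {c y : ℝ} (hy : |y| ≤ c) (θ : ℝ) :
    Real.cosh (θ * c) + y / c * Real.sinh (θ * c) ≤ Real.exp (θ * y + θ ^ 2 * c ^ 2 / 2) := by
  have h := cosh_add_mul_sinh_le_exp (abs_div_self_le_one hy) (θ * c)
  rwa [mul_assoc, mul_div_cancel_of_abs_le hy, mul_pow] at h

variable {Ω : Type*} {m m0 : MeasurableSpace Ω} {μ : Measure Ω} {c k : ℝ≥0}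

theorem integral_mul_condExp [IsFiniteMeasure μ] (hm : m ≤ m0) {V Y : Ω → ℝ}
    (hV : StronglyMeasurable[m] V) (hVY : Integrable (fun ω => V ω * Y ω) μ)
    (hY : Integrable Y μ) : ∫ ω, V ω * (μ[Y | m]) ω ∂μ = ∫ ω, V ω * Y ω ∂μ := by
  rw [← integral_condExp hm (f := fun ω => V ω * Y ω)]
  exact integral_congr_ae (condExp_mul_of_stronglyMeasurable_left hV hVY hY).symm

theorem integrable_mul_exp_sub_condExp {W Y : Ω → ℝ} {c : ℝ}
    (hW : Integrable W μ) (hY : AEStronglyMeasurable Y μ) (hYc : ∀ᵐ ω ∂μ, |Y ω| ≤ c) (θ : ℝ) :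
    Integrable (fun ω => W ω * Real.exp (θ * (Y ω - (μ[Y | m]) ω))) μ := by
  refine hW.mul_bdd (c := Real.exp (|θ| * (c + c))) ?_ ?_
  · exact Real.continuous_exp.comp_aestronglyMeasurable
      ((hY.sub integrable_condExp.aestronglyMeasurable).const_mul θ)
  · filter_upwards [hYc, ae_bdd_abs_condExp_of_ae_bdd_abs (m := m) hYc] with ω hω hω'
    rw [Real.norm_of_nonneg (Real.exp_pos _).le, Real.exp_le_exp]
    refine (le_abs_self _).trans ?_
    rw [abs_mul]
    gcongr
    exact (abs_sub _ _).trans (add_le_add hω hω')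

theorem integrable_mul_exp_neg_mul {W M : Ω → ℝ} {c : ℝ} (hW : Integrable W μ)
    (hM : AEStronglyMeasurable M μ) (hMc : ∀ᵐ ω ∂μ, |M ω| ≤ c) (θ : ℝ) :
    Integrable (fun ω => W ω * Real.exp (-(θ * M ω))) μ := by
  refine hW.mul_bdd (c := Real.exp (|θ| * c))
    (Real.continuous_exp.comp_aestronglyMeasurable (hM.const_mul θ).neg) ?_
  filter_upwards [hMc] with ω hω
  rw [Real.norm_of_nonneg (Real.exp_pos _).le, Real.exp_le_exp]
  calc -(θ * M ω) ≤ |θ| * |M ω| := (neg_le_abs _).trans (abs_mul _ _).le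
    _ ≤ |θ| * c := by gcongr

-- The chord bound makes `exp (θ * Y)` affine in `Y`, so that `Y` may be replaced by its
-- conditional mean.
theorem integral_mul_exp_sub_condExp_le [IsFiniteMeasure μ] (hm : m ≤ m0) {W Y : Ω → ℝ} {c : ℝ}
    (hWm : StronglyMeasurable[m] W) (hW0 : ∀ ω, 0 ≤ W ω) (hW : Integrable W μ)
    (hY : AEStronglyMeasurable Y μ) (hYc : ∀ᵐ ω ∂μ, |Y ω| ≤ c) (θ : ℝ) :
    ∫ ω, W ω * Real.exp (θ * (Y ω - (μ[Y | m]) ω)) ∂μ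
      ≤ Real.exp (θ ^ 2 * c ^ 2 / 2) * ∫ ω, W ω ∂μ := by
  set M := μ[Y | m]
  set V : Ω → ℝ := fun ω => W ω * Real.exp (-(θ * M ω)) with hV
  have hMc : ∀ᵐ ω ∂μ, |M ω| ≤ c := ae_bdd_abs_condExp_of_ae_bdd_abs hYc
  have hMm : AEStronglyMeasurable M μ := integrable_condExp.aestronglyMeasurable
  have hVm : StronglyMeasurable[m] V :=
    hWm.mul (Real.continuous_exp.comp_stronglyMeasurable
      (stronglyMeasurable_condExp.const_mul θ).neg)
  have hV0 (ω : Ω) : 0 ≤ V ω := mul_nonneg (hW0 ω) (Real.exp_pos _).le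
  have hVint : Integrable V μ := integrable_mul_exp_neg_mul hW hMm hMc θ
  have hVY : Integrable (fun ω => V ω * Y ω) μ := hVint.mul_bdd hY hYc
  have hVM : Integrable (fun ω => V ω * M ω) μ := hVint.mul_bdd hMm hMc
  have hVexp (ω : Ω) (y : ℝ) : W ω * Real.exp (y - θ * M ω) = V ω * Real.exp y := by
    rw [hV, sub_eq_neg_add, Real.exp_add, mul_assoc]
  have haffine (y : Ω → ℝ) (ω : Ω) : V ω * (Real.cosh (θ * c) + y ω / c * Real.sinh (θ * c))
      = Real.cosh (θ * c) * V ω + Real.sinh (θ * c) / c * (V ω * y ω) := by ring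
  calc ∫ ω, W ω * Real.exp (θ * (Y ω - M ω)) ∂μ
      ≤ ∫ ω, (Real.cosh (θ * c) * V ω + Real.sinh (θ * c) / c * (V ω * Y ω)) ∂μ := by
        refine integral_mono_ae (integrable_mul_exp_sub_condExp hW hY hYc θ)
          ((hVint.const_mul _).add (hVY.const_mul _)) ?_
        filter_upwards [hYc] with ω hω
        rw [mul_sub, hVexp, ← haffine]
        exact mul_le_mul_of_nonneg_left (exp_mul_le_cosh_add_div_mul_sinh hω θ) (hV0 ω)
    _ = ∫ ω, (Real.cosh (θ * c) * V ω + Real.sinh (θ * c) / c * (V ω * M ω)) ∂μ := by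
        rw [integral_add (hVint.const_mul _) (hVY.const_mul _), integral_const_mul,
          integral_const_mul, ← integral_mul_condExp hm hVm hVY (.of_bound hY c hYc),
          integral_add (hVint.const_mul _) (hVM.const_mul _), integral_const_mul,
          integral_const_mul]
    _ ≤ ∫ ω, Real.exp (θ ^ 2 * c ^ 2 / 2) * W ω ∂μ := by
        refine integral_mono_ae ((hVint.const_mul _).add (hVM.const_mul _)) (hW.const_mul _) ?_
        filter_upwards [hMc] with ω hω
        rw [← haffine, mul_comm _ (W ω)]
        refine (mul_le_mul_of_nonneg_left (cosh_add_div_mul_sinh_le_exp hω θ) (hV0 ω)).trans_eq ?_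
        rw [← hVexp, add_sub_cancel_left]
    _ = _ := integral_const_mul _ _

theorem hasSubgaussianMGF_add_sub_condExp [IsFiniteMeasure μ] (hm : m ≤ m0) {S Y : Ω → ℝ}
    (hS : StronglyMeasurable[m] S) (hSk : HasSubgaussianMGF S k μ)
    (hY : AEStronglyMeasurable Y μ) (hYc : ∀ᵐ ω ∂μ, |Y ω| ≤ c) :
    HasSubgaussianMGF (fun ω => S ω + (Y ω - (μ[Y | m]) ω)) (k + c ^ 2) μ := by
  have hsplit (θ : ℝ) : (fun ω => Real.exp (θ * (S ω + (Y ω - (μ[Y | m]) ω))))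
      = fun ω => Real.exp (θ * S ω) * Real.exp (θ * (Y ω - (μ[Y | m]) ω)) := by
    simp only [mul_add, Real.exp_add]
  refine ⟨fun θ => ?_, fun θ => ?_⟩
  · rw [hsplit]
    exact integrable_mul_exp_sub_condExp (hSk.integrable_exp_mul θ) hY hYc θ
  · rw [mgf, hsplit]
    calc ∫ ω, Real.exp (θ * S ω) * Real.exp (θ * (Y ω - (μ[Y | m]) ω)) ∂μ
        ≤ Real.exp (θ ^ 2 * c ^ 2 / 2) * mgf S μ θ :=
          integral_mul_exp_sub_condExp_le hm
            (Real.continuous_exp.comp_stronglyMeasurable (hS.const_mul θ))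
            (fun ω => (Real.exp_pos _).le) (hSk.integrable_exp_mul θ) hY hYc θ
      _ ≤ Real.exp (θ ^ 2 * c ^ 2 / 2) * Real.exp (k * θ ^ 2 / 2) := by
          gcongr
          exact hSk.mgf_le θ
      _ = Real.exp ((k + c ^ 2 : ℝ≥0) * θ ^ 2 / 2) := by
          rw [← Real.exp_add]
          congr 1
          push_cast
          ring

theorem hasSubgaussianMGF_mono {X : Ω → ℝ} {k' : ℝ≥0} (hX : HasSubgaussianMGF X k μ)
    (hk : k ≤ k') : HasSubgaussianMGF X k' μ :=
  ⟨hX.integrable_exp_mul, fun t => (hX.mgf_le t).trans (Real.exp_le_exp.2 (by gcongr))⟩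

variable [IsProbabilityMeasure μ] {ℱ : Filtration ℕ m0} {Y : ℕ → Ω → ℝ}

-- Within one residue class modulo the lag, each term is measurable before the next one is averaged.
theorem hasSubgaussianMGF_sum_filter_mod {p : ℕ}
    (hY : ∀ s, StronglyMeasurable[ℱ (s + p)] (Y s)) (hYc : ∀ s, ∀ᵐ ω ∂μ, |Y s ω| ≤ c) (r N : ℕ) :
    HasSubgaussianMGF (fun ω => ∑ s ∈ Finset.range N with s % p = r, (Y s ω - (μ[Y s | ℱ s]) ω))
      (((Finset.range N).filter (· % p = r)).card • c ^ 2) μ := by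
  induction N with
  | zero => simp
  | succ N ih =>
    rw [Finset.range_add_one, Finset.filter_insert]
    split_ifs with hr
    · have hN : N ∉ (Finset.range N).filter fun s => s % p = r := by simp
      have hS : StronglyMeasurable[ℱ N] fun ω =>
          ∑ s ∈ Finset.range N with s % p = r, (Y s ω - (μ[Y s | ℱ s]) ω) := by
        refine Finset.stronglyMeasurable_fun_sum _ fun s hs => ?_
        obtain ⟨hsN, hsr⟩ := Finset.mem_filter.1 hs
        have hlt : s < N := Finset.mem_range.1 hsN
        have hlag : p ≤ N - s := Nat.le_of_dvd (Nat.sub_pos_of_lt hlt)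
          ((Nat.modEq_iff_dvd' hlt.le).1 (hsr.trans hr.symm))
        exact ((hY s).mono (ℱ.mono (by omega))).sub
          (stronglyMeasurable_condExp.mono (ℱ.mono (by omega)))
      rw [Finset.card_insert_of_notMem hN, succ_nsmul]
      simp only [Finset.sum_insert hN, add_comm (Y N _ - _)]
      exact hasSubgaussianMGF_add_sub_condExp (ℱ.le N) hS ih
        ((hY N).mono (ℱ.le _)).aestronglyMeasurable (hYc N)
    · exact ih

theorem card_filter_mod_eq_le (d N : ℕ) {r : ℕ} (hr : r < d + 1) :
    (d + 1) * ((Finset.range N).filter (· % (d + 1) = r)).card ≤ N + d := by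
  have hcount : ((Finset.range N).filter (· % (d + 1) = r)).card
      = N.count (· ≡ r [MOD d + 1]) := by
    simp only [Nat.count_eq_card_filter_range, Nat.ModEq, Nat.mod_eq_of_lt hr]
  have hdiv := Nat.div_add_mod N (d + 1)
  rw [hcount, Nat.count_modEq_card N (by omega : 0 < d + 1), mul_add]
  split_ifs <;> omega

theorem hasSubgaussianMGF_sum_range {X : ℕ → Ω → ℝ} {p : ℕ}
    (hX : ∀ r < p, HasSubgaussianMGF (X r) k μ) :
    HasSubgaussianMGF (fun ω => ∑ r ∈ Finset.range p, X r ω) (p ^ 2 * k) μ := by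
  induction p with
  | zero => simp
  | succ p ih =>
    simp only [Finset.sum_range_succ]
    convert! (ih fun r hr => hX r (by omega)).add (hX p (by omega)) using 1
    rw [NNReal.sqrt_mul, NNReal.sqrt_sq, ← add_one_mul, mul_pow, NNReal.sq_sqrt]
    push_cast
    rfl

theorem hasSubgaussianMGF_sum_sub_condExp {d : ℕ}
    (hY : ∀ s, StronglyMeasurable[ℱ (s + (d + 1))] (Y s)) (hYc : ∀ s, ∀ᵐ ω ∂μ, |Y s ω| ≤ c)
    (N : ℕ) :
    HasSubgaussianMGF (fun ω => ∑ s ∈ Finset.range N, (Y s ω - (μ[Y s | ℱ s]) ω))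
      ((d + 1) * (N + d) * c ^ 2) μ := by
  have hblock : ∀ r < d + 1, HasSubgaussianMGF
      (fun ω => ∑ s ∈ Finset.range N with s % (d + 1) = r, (Y s ω - (μ[Y s | ℱ s]) ω))
      ((N + d) / (d + 1) * c ^ 2) μ := fun r hr => by
    refine hasSubgaussianMGF_mono (hasSubgaussianMGF_sum_filter_mod hY hYc r N) ?_
    rw [nsmul_eq_mul]
    gcongr
    rw [le_div_iff₀' (by positivity)]
    exact_mod_cast card_filter_mod_eq_le d N hr
  convert! hasSubgaussianMGF_sum_range hblock using 1
  · funext ω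
    exact (Finset.sum_fiberwise_of_maps_to
      (fun s _ => Finset.mem_range.2 (Nat.mod_lt s d.succ_pos)) _).symm
  · push_cast
    field_simp

end Concentration

section ConditionalLaw

variable {Ω Ξ S ι : Type*} {m m0 : MeasurableSpace Ω} [MeasurableSpace Ξ] [MeasurableSpace S]
  {μ : Measure Ω}

theorem map_prodMk_restrict_eq_compProd [IsFiniteMeasure μ] (hm : m ≤ m0) {κ : Kernel S Ξ}
    [IsMarkovKernel κ] {Y : Ω → S} {Z : Ω → Ξ} (hY : Measurable[m] Y) (hZ : Measurable Z)
    (hlaw : ∀ A, MeasurableSet A →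
      μ[(Z ⁻¹' A).indicator (fun _ => (1 : ℝ)) | m] =ᵐ[μ] fun ω => (κ (Y ω)).real A)
    {s : Set Ω} (hs : MeasurableSet[m] s) :
    (μ.restrict s).map (fun ω => (Y ω, Z ω)) = (μ.restrict s).map Y ⊗ₘ κ := by
  have hY' : Measurable Y := hY.mono hm le_rfl
  refine Measure.ext_prod fun {u v} hu hv => ?_
  have hus : MeasurableSet[m] (Y ⁻¹' u ∩ s) := (hY hu).inter hs
  have hκint : Integrable (fun ω => (κ (Y ω)).real v) (μ.restrict (Y ⁻¹' u ∩ s)) :=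
    .of_bound ((κ.measurable_coe hv).comp hY').ennreal_toReal.aestronglyMeasurable 1
      (ae_of_all _ fun ω => by
        rw [Real.norm_of_nonneg measureReal_nonneg]; exact measureReal_le_one)
  have hreal : ∫ ω in Y ⁻¹' u ∩ s, (κ (Y ω)).real v ∂μ = μ.real (Z ⁻¹' v ∩ (Y ⁻¹' u ∩ s)) := by
    rw [← setIntegral_congr_ae (hm _ hus) ((hlaw v hv).mono fun ω h _ => h),
      setIntegral_condExp hm ((integrable_const 1).indicator (hZ hv)) hus,
      integral_indicator_const _ (hZ hv), smul_eq_mul, mul_one,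
      measureReal_restrict_apply (hZ hv)]
  calc (μ.restrict s).map (fun ω => (Y ω, Z ω)) (u ×ˢ v)
      = μ (Z ⁻¹' v ∩ (Y ⁻¹' u ∩ s)) := by
        rw [Measure.map_apply (hY'.prodMk hZ) (hu.prod hv),
          Measure.restrict_apply ((hY'.prodMk hZ) (hu.prod hv)), Set.mk_preimage_prod,
          Set.inter_comm (Y ⁻¹' u), Set.inter_assoc]
    _ = ENNReal.ofReal (∫ ω in Y ⁻¹' u ∩ s, (κ (Y ω)).real v ∂μ) := by
        rw [hreal, ofReal_measureReal]
    _ = ∫⁻ ω in Y ⁻¹' u ∩ s, κ (Y ω) v ∂μ := by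
        rw [ofReal_integral_eq_lintegral_ofReal hκint (ae_of_all _ fun ω => measureReal_nonneg)]
        exact lintegral_congr fun ω => ofReal_measureReal
    _ = ((μ.restrict s).map Y ⊗ₘ κ) (u ×ˢ v) := by
        rw [Measure.compProd_apply_prod hu hv, setLIntegral_map hu (κ.measurable_coe hv) hY',
          Measure.restrict_restrict (hY' hu)]

theorem condExp_comp_prodMk_eq_integral [IsFiniteMeasure μ] (hm : m ≤ m0) {κ : Kernel S Ξ}
    [IsMarkovKernel κ] {Y : Ω → S} {Z : Ω → Ξ} (hY : Measurable[m] Y) (hZ : Measurable Z)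
    (hlaw : ∀ A, MeasurableSet A →
      μ[(Z ⁻¹' A).indicator (fun _ => (1 : ℝ)) | m] =ᵐ[μ] fun ω => (κ (Y ω)).real A)
    {Φ : S × Ξ → ℝ} (hΦ : Measurable Φ) {c : ℝ} (hc : ∀ q, |Φ q| ≤ c) :
    μ[fun ω => Φ (Y ω, Z ω) | m] =ᵐ[μ] fun ω => ∫ z, Φ (Y ω, z) ∂κ (Y ω) := by
  have hY' : Measurable Y := hY.mono hm le_rfl
  have hinner : StronglyMeasurable fun y => ∫ z, Φ (y, z) ∂κ y :=
    hΦ.stronglyMeasurable.integral_kernel_prod_right'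
  refine (ae_eq_condExp_of_forall_setIntegral_eq hm ?_ ?_ ?_ ?_).symm
  · exact .of_bound (hΦ.comp (hY'.prodMk hZ)).aestronglyMeasurable c (ae_of_all _ fun ω => hc _)
  · refine fun s _ _ => (Integrable.of_bound
      (hinner.comp_measurable hY').aestronglyMeasurable c (ae_of_all _ fun ω => ?_)).integrableOn
    simpa using norm_integral_le_of_norm_le_const (μ := κ (Y ω)) (f := fun z => Φ (Y ω, z))
      (ae_of_all _ fun z => hc (Y ω, z))
  · intro s hs _
    rw [← integral_map (φ := Y) (f := fun y => ∫ z, Φ (y, z) ∂κ y) hY'.aemeasurable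
      hinner.aestronglyMeasurable, ← Measure.integral_compProd
        (.of_bound hΦ.aestronglyMeasurable c (ae_of_all _ hc)),
      ← map_prodMk_restrict_eq_compProd hm hY hZ hlaw hs,
      integral_map (hY'.prodMk hZ).aemeasurable hΦ.aestronglyMeasurable]
  · exact (hinner.comp_measurable hY).aestronglyMeasurable

theorem comp_eq_sum_indicator [Fintype ι] (τ : Ω → ι) (U : ι → Ω → ℝ) :
    (fun ω => U (τ ω) ω) = ∑ i, (τ ⁻¹' {i}).indicator (U i) := by
  classical
  ext ω
  simp [Set.indicator_apply, eq_comm]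

variable [MeasurableSpace ι] [MeasurableSingletonClass ι]

theorem condExp_comp_index [Finite ι] (hm : m ≤ m0) {τ : Ω → ι} (hτ : Measurable[m] τ)
    {U : ι → Ω → ℝ} (hU : ∀ i, Integrable (U i) μ) :
    μ[fun ω => U (τ ω) ω | m] =ᵐ[μ] fun ω => (μ[U (τ ω) | m]) ω := by
  have := Fintype.ofFinite ι
  rw [comp_eq_sum_indicator, comp_eq_sum_indicator τ fun i => μ[U i | m]]
  exact (condExp_finsetSum
    (fun i _ => (hU i).indicator (hm _ (hτ (measurableSet_singleton i)))) m).trans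
    (eventuallyEq_sum fun i _ => condExp_indicator (hU i) (hτ (measurableSet_singleton i)))

variable [Fintype ι]

theorem condExp_comp_eq_sum [IsFiniteMeasure μ] {τ : Ω → ι} (hτ : Measurable τ) (v : ι → ℝ) :
    μ[fun ω => v (τ ω) | m]
      =ᵐ[μ] ∑ i, v i • μ[(τ ⁻¹' {i}).indicator (fun _ => (1 : ℝ)) | m] := by
  have hsum : (fun ω => v (τ ω)) = ∑ i, v i • (τ ⁻¹' {i}).indicator fun _ => (1 : ℝ) := by
    rw [comp_eq_sum_indicator τ fun i _ => v i]
    refine Finset.sum_congr rfl fun i _ => ?_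
    ext ω
    by_cases hω : ω ∈ τ ⁻¹' {i} <;> simp [hω]
  rw [hsum]
  exact (condExp_finsetSum (fun i _ => ((integrable_const _).indicator
    (hτ (measurableSet_singleton i))).smul (v i)) m).trans
    (eventuallyEq_sum fun i _ => condExp_smul _ _ m)

/-- The kernel whose law at `i` is the mixture of the laws `loc j` with the weights `A i j`. -/
def mixtureKernel (loc : ι → Measure Ξ) (A : Matrix ι ι ℝ) : Kernel ι Ξ :=
  .ofFunOfCountable fun i => ∑ j, ENNReal.ofReal (A i j) • loc j

theorem integral_mixtureKernel {loc : ι → Measure Ξ} {A : Matrix ι ι ℝ} (hA : ∀ i j, 0 ≤ A i j)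
    (i : ι) {f : Ξ → ℝ} (hf : ∀ j, Integrable f (loc j)) :
    ∫ z, f z ∂mixtureKernel loc A i = (A *ᵥ fun j => ∫ z, f z ∂loc j) i := by
  change ∫ z, f z ∂(∑ j, ENNReal.ofReal (A i j) • loc j) = _
  rw [integral_finsetSum_measure fun j _ => (hf j).smul_measure ENNReal.ofReal_ne_top]
  simp only [integral_smul_measure, ENNReal.toReal_ofReal (hA _ _), smul_eq_mul, Matrix.mulVec,
    dotProduct]

theorem isMarkovKernel_mixtureKernel [DecidableEq ι] {loc : ι → Measure Ξ}
    [∀ i, IsProbabilityMeasure (loc i)] {A : Matrix ι ι ℝ} (hA : A ∈ doublyStochastic ℝ ι) :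
    IsMarkovKernel (mixtureKernel loc A) := by
  refine ⟨fun i => ⟨?_⟩⟩
  change (∑ j, ENNReal.ofReal (A i j) • loc j) Set.univ = 1
  simp only [Measure.finsetSum_apply, Measure.smul_apply, measure_univ, smul_eq_mul, mul_one]
  rw [← ENNReal.ofReal_sum_of_nonneg fun j _ => nonneg_of_mem_doublyStochastic hA,
    sum_row_of_mem_doublyStochastic hA, ENNReal.ofReal_one]

end ConditionalLaw

section Sampling

variable {Ω Ξ : Type*} {m0 : MeasurableSpace Ω} [MeasurableSpace Ξ] {μ : Measure Ω} {n : ℕ}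
  {loc : Fin n → Measure Ξ} {P : ℕ → Ω → Matrix (Fin n) (Fin n) ℝ} {token : ℕ → Ω → Fin n}
  {ξ : ℕ → Ω → Ξ}

theorem history_mono : Monotone (history P token ξ) := fun _ _ hst =>
  sup_le_sup (biSup_mono fun _ hr => Finset.Icc_subset_Icc_right hst hr)
    (biSup_mono fun _ hr => Finset.Icc_subset_Icc_right hst hr)

theorem measurable_token_history (t : ℕ) : Measurable[history P token ξ t] (token t) :=
  measurable_iff_comap_le.2 <|
    (le_biSup (fun s => MeasurableSpace.comap (token s) ⊤)
      (Finset.mem_Icc.2 ⟨Nat.zero_le t, le_rfl⟩)).trans le_sup_left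

theorem measurable_sample_history {t : ℕ} (ht : 1 ≤ t) : Measurable[history P token ξ t] (ξ t) :=
  measurable_iff_comap_le.2 <| le_sup_right.trans <|
    (le_biSup (fun s => matrixSigma (P s) ⊔ MeasurableSpace.comap (ξ s) inferInstance)
      (Finset.mem_Icc.2 ⟨ht, le_rfl⟩)).trans le_sup_right

theorem measurable_matrixSigma_mulVec (Q : Ω → Matrix (Fin n) (Fin n) ℝ) (v : Fin n → ℝ)
    (i : Fin n) : Measurable[matrixSigma Q] fun ω => (Q ω *ᵥ v) i := by
  simp only [Matrix.mulVec, dotProduct]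
  exact Finset.measurable_fun_sum _ fun j _ =>
    (measurable_iff_comap_le.2 (le_iSup₂_of_le i j le_rfl)).mul_const (v j)

namespace IsRandomMIGDSampling

theorem matrixSigma_le (h : IsRandomMIGDSampling μ loc P token ξ) {t : ℕ} (ht : 1 ≤ t) :
    matrixSigma (P t) ≤ m0 :=
  iSup₂_le fun i j => (h.measurable_matrix t ht i j).comap_le

theorem history_le (h : IsRandomMIGDSampling μ loc P token ξ) (t : ℕ) :
    history P token ξ t ≤ m0 :=
  sup_le (iSup₂_le fun s _ => (h.measurable_token s).comap_le) <| iSup₂_le fun s hs =>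
    have hs₁ := (Finset.mem_Icc.1 hs).1
    sup_le (h.matrixSigma_le hs₁) (h.measurable_sample s hs₁).comap_le

theorem history_sup_matrixSigma_le (h : IsRandomMIGDSampling μ loc P token ξ) (t : ℕ) :
    history P token ξ t ⊔ matrixSigma (P (t + 1)) ≤ m0 :=
  sup_le (h.history_le t) (h.matrixSigma_le (Nat.le_add_left 1 t))

/-- The filtration of the histories. -/
def filtration (h : IsRandomMIGDSampling μ loc P token ξ) : Filtration ℕ m0 where
  seq := history P token ξ
  mono' := history_mono
  le' := h.history_le

theorem meanMatrix_succ (h : IsRandomMIGDSampling μ loc P token ξ) (t : ℕ) :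
    meanMatrix μ (P (t + 1)) = meanMatrix μ (P 1) := by
  ext i j
  exact ((h.identDistrib (t + 1) (Nat.le_add_left 1 t)).comp
    (u := fun q : Fin n → Fin n → ℝ => q i j) (by fun_prop)).integral_eq

variable [IsProbabilityMeasure μ]

theorem integrable_mulVec (h : IsRandomMIGDSampling μ loc P token ξ) (t : ℕ) (v : Fin n → ℝ)
    (i : Fin n) : Integrable (fun ω => (P (t + 1) ω *ᵥ v) i) μ := by
  simp only [Matrix.mulVec, dotProduct]
  exact integrable_finsetSum _ fun j _ => (integrable_of_ae_mem_doublyStochastic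
    (h.measurable_matrix _ t.succ_pos) (h.doublyStochastic _ t.succ_pos) i j).mul_const _

theorem condExp_comp_token_succ (h : IsRandomMIGDSampling μ loc P token ξ) (t : ℕ)
    (v : Fin n → ℝ) :
    μ[fun ω => v (token (t + 1) ω) | history P token ξ t]
      =ᵐ[μ] fun ω => (meanMatrix μ (P 1) *ᵥ v) (token t ω) := by
  have hstep : μ[fun ω => v (token (t + 1) ω) | history P token ξ t ⊔ matrixSigma (P (t + 1))]
      =ᵐ[μ] fun ω => (P (t + 1) ω *ᵥ v) (token t ω) := by
    filter_upwards [condExp_comp_eq_sum (m := history P token ξ t ⊔ matrixSigma (P (t + 1)))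
      (h.measurable_token (t + 1)) v, ae_all_iff.2 (h.token_law t)] with ω hω hlaw
    simp [hω, hlaw, Matrix.mulVec, dotProduct, mul_comm]
  have hmean (i : Fin n) : μ[fun ω => (P (t + 1) ω *ᵥ v) i | history P token ξ t]
      =ᵐ[μ] fun _ => (meanMatrix μ (P 1) *ᵥ v) i := by
    rw [← h.meanMatrix_succ t, meanMatrix_mulVec_apply fun i j =>
      integrable_of_ae_mem_doublyStochastic (h.measurable_matrix _ t.succ_pos)
        (h.doublyStochastic _ t.succ_pos) i j]
    exact condExp_indep_eq (h.matrixSigma_le t.succ_pos) (h.history_le t)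
      (measurable_matrixSigma_mulVec _ v i).stronglyMeasurable (h.indep t)
  calc μ[fun ω => v (token (t + 1) ω) | history P token ξ t]
      =ᵐ[μ] μ[fun ω => (P (t + 1) ω *ᵥ v) (token t ω) | history P token ξ t] :=
        (condExp_condExp_of_le le_sup_left (h.history_sup_matrixSigma_le t)).symm.trans
          (condExp_congr_ae hstep)
    _ =ᵐ[μ] fun ω => (μ[fun ω' => (P (t + 1) ω' *ᵥ v) (token t ω) | history P token ξ t]) ω :=
        condExp_comp_index (U := fun i ω => (P (t + 1) ω *ᵥ v) i) (h.history_le t)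
          (measurable_token_history t) (h.integrable_mulVec t v)
    _ =ᵐ[μ] fun ω => (meanMatrix μ (P 1) *ᵥ v) (token t ω) := by
        filter_upwards [ae_all_iff.2 hmean] with ω hω using hω _

theorem condExp_comp_token_add (h : IsRandomMIGDSampling μ loc P token ξ) (t p : ℕ)
    (v : Fin n → ℝ) :
    μ[fun ω => v (token (t + p) ω) | history P token ξ t]
      =ᵐ[μ] fun ω => (meanMatrix μ (P 1) ^ p *ᵥ v) (token t ω) := by
  induction p generalizing v with
  | zero =>
    simp only [add_zero, pow_zero, Matrix.one_mulVec]
    exact (condExp_of_stronglyMeasurable (h.history_le t)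
      (measurable_of_finite v |>.comp (measurable_token_history t)).stronglyMeasurable
      (Integrable.of_finite.comp_measurable (h.measurable_token t))).eventuallyEq
  | succ p ih =>
    rw [pow_succ, ← Matrix.mulVec_mulVec, ← add_assoc]
    exact (condExp_condExp_of_le (history_mono (Nat.le_add_right t p)) (h.history_le _)).symm.trans
      ((condExp_congr_ae (h.condExp_comp_token_succ (t + p) v)).trans (ih _))

theorem condExp_indicator_sample (h : IsRandomMIGDSampling μ loc P token ξ) (t : ℕ) {p : ℕ}
    (hp : 1 ≤ p) {A : Set Ξ} (hA : MeasurableSet A) :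
    μ[(ξ (t + p) ⁻¹' A).indicator (fun _ => (1 : ℝ)) | history P token ξ t]
      =ᵐ[μ] fun ω => (meanMatrix μ (P 1) ^ p *ᵥ fun j => (loc j).real A) (token t ω) := by
  obtain ⟨k, rfl⟩ := Nat.exists_eq_add_of_le' hp
  have hle : history P token ξ t ≤ history P token ξ (t + k) ⊔ matrixSigma (P (t + k + 1)) ⊔
      MeasurableSpace.comap (token (t + k + 1)) ⊤ :=
    (history_mono (Nat.le_add_right t k)).trans (le_sup_left.trans le_sup_left)
  exact ((condExp_condExp_of_le hle (sup_le (h.history_sup_matrixSigma_le _)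
    (h.measurable_token _).comap_le)).symm.trans
    (condExp_congr_ae (h.sample_law (t + k) A hA))).trans
      (h.condExp_comp_token_add t (k + 1) fun j => (loc j).real A)

theorem pow_meanMatrix_mem_doublyStochastic (h : IsRandomMIGDSampling μ loc P token ξ) (p : ℕ) :
    meanMatrix μ (P 1) ^ p ∈ _root_.doublyStochastic ℝ (Fin n) :=
  pow_mem (meanMatrix_mem_doublyStochastic (h.measurable_matrix 1 le_rfl)
    (h.doublyStochastic 1 le_rfl)) p

theorem ae_sample_mem (h : IsRandomMIGDSampling μ loc P token ξ) {A : Set Ξ}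
    (hA : MeasurableSet A) (hA₀ : ∀ i, loc i Aᶜ = 0) : ∀ᵐ ω ∂μ, ∀ t, 1 ≤ t → ξ t ω ∈ A := by
  refine ae_all_iff.2 fun t => ae_all_iff.2 fun ht => ?_
  have hpre : MeasurableSet (ξ t ⁻¹' Aᶜ) := h.measurable_sample _ ht hA.compl
  have hlaw := h.condExp_indicator_sample 0 ht hA.compl
  have hint : ∫ ω, (ξ t ⁻¹' Aᶜ).indicator (fun _ => (1 : ℝ)) ω ∂μ = 0 := by
    rw [zero_add] at hlaw
    rw [← integral_condExp (h.history_le 0), integral_congr_ae hlaw]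
    simp [Measure.real, hA₀, Matrix.mulVec, dotProduct]
  rw [integral_indicator_const _ hpre, smul_eq_mul, mul_one, measureReal_eq_zero_iff] at hint
  filter_upwards [measure_eq_zero_iff_ae_notMem.1 hint] with ω hω
  simpa using hω

theorem condExp_comp_sample [∀ i, IsProbabilityMeasure (loc i)]
    (h : IsRandomMIGDSampling μ loc P token ξ) {S : Type*} [MeasurableSpace S] (t : ℕ) {p : ℕ}
    (hp : 1 ≤ p) {x : Ω → S} (hx : Measurable[history P token ξ t] x) {H : S × Ξ → ℝ}
    (hH : Measurable H) {c : ℝ} (hc : ∀ q, |H q| ≤ c) :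
    μ[fun ω => H (x ω, ξ (t + p) ω) | history P token ξ t] =ᵐ[μ] fun ω =>
      (meanMatrix μ (P 1) ^ p *ᵥ fun j => ∫ z, H (x ω, z) ∂loc j) (token t ω) := by
  set A := meanMatrix μ (P 1) ^ p
  have hA : A ∈ _root_.doublyStochastic ℝ (Fin n) := h.pow_meanMatrix_mem_doublyStochastic p
  have hA₀ (i j : Fin n) : 0 ≤ A i j := nonneg_of_mem_doublyStochastic hA
  have : IsMarkovKernel (mixtureKernel loc A) := isMarkovKernel_mixtureKernel hA
  let κ : Kernel (S × Fin n) Ξ := (mixtureKernel loc A).comap Prod.snd measurable_snd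
  have hlaw (B : Set Ξ) (hB : MeasurableSet B) :
      μ[(ξ (t + p) ⁻¹' B).indicator (fun _ => (1 : ℝ)) | history P token ξ t]
        =ᵐ[μ] fun ω => (κ (x ω, token t ω)).real B := by
    filter_upwards [h.condExp_indicator_sample t hp hB] with ω hω
    simp only [hω, ← integral_indicator_one hB]
    exact (integral_mixtureKernel hA₀ _ fun j => (integrable_const 1).indicator hB).symm
  filter_upwards [condExp_comp_prodMk_eq_integral (h.history_le t)
    (hx.prodMk (measurable_token_history t)) (h.measurable_sample _ (by omega)) hlaw
    (hH.comp (by fun_prop : Measurable fun q : (S × Fin n) × Ξ => (q.1.1, q.2)))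
    fun q => hc _] with ω hω
  refine hω.trans (integral_mixtureKernel hA₀ _ fun j => ?_)
  exact .of_bound (hH.comp measurable_prodMk_left).aestronglyMeasurable c
    (ae_of_all _ fun z => hc _)

end IsRandomMIGDSampling

end Sampling

section DenseRange

variable {E ι : Type*} [TopologicalSpace E] {X : Set E} {f : E → ℝ} {e : ι → X}

theorem exists_forall_denseRange_le_add (hf : ContinuousOn f X) (he : DenseRange e) {x : E}
    (hx : x ∈ X) (hmin : IsMinOn f X x) {η : ℝ} (hη : 0 < η) :
    ∃ k, ∀ l, f (e k) ≤ f (e l) + η := by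
  have hopen : IsOpen {y : X | f y < f x + η} :=
    isOpen_lt (continuousOn_iff_continuous_domRestrict.1 hf) continuous_const
  obtain ⟨k, hk⟩ := he.exists_mem_open hopen ⟨⟨x, hx⟩, lt_add_of_pos_right _ hη⟩
  exact ⟨k, fun l => hk.le.trans (add_le_add_left (hmin (e l).2) η)⟩

theorem le_of_forall_denseRange_le (hf : ContinuousOn f X) (he : DenseRange e) {b : ℝ}
    (h : ∀ l, b ≤ f (e l)) {x : E} (hx : x ∈ X) : b ≤ f x :=
  he.induction_on (p := fun y : X => b ≤ f y) ⟨x, hx⟩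
    (isClosed_le continuous_const (continuousOn_iff_continuous_domRestrict.1 hf)) h

end DenseRange

section Measurability

variable {Ω E : Type*} {m : MeasurableSpace Ω} [NormedAddCommGroup E] [MeasurableSpace E]
  [BorelSpace E] {X : Set E} {ψ : E → ℝ}

theorem measurable_comp_of_continuousOn {f : E → ℝ} (hf : ContinuousOn f X) {x : Ω → E}
    (hx : Measurable x) (hxX : ∀ ω, x ω ∈ X) : Measurable fun ω => f (x ω) :=
  (continuousOn_iff_continuous_domRestrict.1 hf).measurable.comp (hx.subtype_mk (h := hxX))

variable [SecondCountableTopology E]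

theorem measurable_of_forall_add_sq_norm_le {obj : E → Ω → ℝ} {x : Ω → E} {c : ℝ} (hc : 0 < c)
    (hobj : ∀ y ∈ X, Measurable (obj y)) (hcont : ∀ ω, ContinuousOn (obj · ω) X)
    (hxX : ∀ ω, x ω ∈ X) (hx : ∀ ω, ∀ y ∈ X, obj (x ω) ω + c * ‖y - x ω‖ ^ 2 ≤ obj y ω) :
    Measurable x := by
  classical
  rcases isEmpty_or_nonempty Ω with _ | ⟨⟨ω₀⟩⟩
  · exact measurable_of_empty x
  have : Nonempty X := ⟨⟨x ω₀, hxX ω₀⟩⟩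
  let e : ℕ → X := TopologicalSpace.denseSeq X
  have he : DenseRange e := TopologicalSpace.denseRange_denseSeq X
  let η : ℕ → ℝ := fun k => 1 / ((k : ℝ) + 1)
  have hη : ∀ k, 0 < η k := fun k => by positivity
  have hmin : ∀ ω, IsMinOn (obj · ω) X (x ω) := fun ω y hy =>
    (le_add_of_nonneg_right (by positivity)).trans (hx ω y hy)
  have hex : ∀ k ω, ∃ j, ∀ l, obj (e j) ω ≤ obj (e l) ω + c * η k ^ 2 := fun k ω =>
    exists_forall_denseRange_le_add (hcont ω) he (hxX ω) (hmin ω) (by have := hη k; positivity)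
  let approx : ℕ → Ω → E := fun k ω => e (Nat.find (hex k ω))
  have hmeas : ∀ k, Measurable (approx k) := fun k => by
    refine (Measurable.of_discrete (f := fun j => (e j : E))).comp (measurable_find (hex k) ?_)
    refine fun j => measurableSet_setOfPred.2 (.forall fun l => measurableSet_setOfPred.1 ?_)
    exact measurableSet_le (hobj _ (e j).2) ((hobj _ (e l).2).add_const _)
  have hdist : ∀ k ω, ‖approx k ω - x ω‖ ≤ η k := fun k ω => by
    have happrox : obj (approx k ω) ω - c * η k ^ 2 ≤ obj (x ω) ω :=
      le_of_forall_denseRange_le (hcont ω) he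
        (fun l => sub_le_iff_le_add.2 (Nat.find_spec (hex k ω) l)) (hxX ω)
    have hsq : c * ‖approx k ω - x ω‖ ^ 2 ≤ c * η k ^ 2 := by
      linarith [hx ω (approx k ω) (e _).2]
    exact (sq_le_sq₀ (norm_nonneg _) (hη k).le).1 (le_of_mul_le_mul_left hsq hc)
  refine measurable_of_tendsto_metrizable hmeas (tendsto_pi_nhds.2 fun ω => ?_)
  exact tendsto_iff_norm_sub_tendsto_zero.2 (squeeze_zero (fun _ => norm_nonneg _)
    (hdist · ω) tendsto_one_div_add_atTop_nhds_zero_nat)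

variable [NormedSpace ℝ E]

theorem measurable_bregman (hψ : DifferentiableOn ℝ ψ X) (hX : Convex ℝ X) {x : Ω → E}
    (hx : Measurable x) (hxX : ∀ ω, x ω ∈ X) {y : E} (hy : y ∈ X) :
    Measurable fun ω => bregman ψ X y (x ω) := by
  have hψx := measurable_comp_of_continuousOn hψ.continuousOn hx hxX
  let r : ℕ → ℝ := fun k => 1 / ((k : ℝ) + 1)
  have hmem : ∀ k ω, x ω + r k • (y - x ω) ∈ X := fun k ω =>
    hX.add_smul_sub_mem (hxX ω) hy
      ⟨by positivity, div_le_one_of_le₀ (by linarith [k.cast_nonneg (α := ℝ)]) (by positivity)⟩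
  have hslope : ∀ ω, Tendsto (fun k : ℕ => ((k : ℝ) + 1) • (ψ (x ω + r k • (y - x ω)) - ψ (x ω)))
      atTop (𝓝 (fderivWithin ℝ ψ X (x ω) (y - x ω))) := fun ω => by
    refine (hψ _ (hxX ω)).hasFDerivWithinAt.lim ?_ (.of_forall fun k => hmem k ω) ?_
    · simpa [r] using (tendsto_one_div_add_atTop_nhds_zero_nat (𝕜 := ℝ)).smul_const (y - x ω)
    · refine tendsto_const_nhds.congr fun k => ?_
      rw [smul_smul, mul_one_div_cancel (by positivity), one_smul]
  refine (measurable_const.sub hψx).sub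
    (measurable_of_tendsto_metrizable (fun k => ?_) (tendsto_pi_nhds.2 hslope))
  exact ((measurable_comp_of_continuousOn hψ.continuousOn (by fun_prop) (hmem k)).sub
    hψx).const_mul _

theorem measurable_mirrorStep (hψ : IsProxFunction ψ X) {a : ℝ} (ha : 0 < a)
    {g : Ω → E →L[ℝ] ℝ} {x x' : Ω → E} (hg : Measurable g) (hx : Measurable x)
    (hxX : ∀ ω, x ω ∈ X) (hstep : ∀ ω, IsMirrorStep ψ X a (g ω) (x ω) (x' ω)) :
    Measurable x' := by
  refine measurable_of_forall_add_sq_norm_le (X := X) one_half_pos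
    (obj := fun y ω => a * g ω y + bregman ψ X y (x ω)) (fun y hy => ?_) (fun ω => ?_)
    (fun ω => (hstep ω).1) fun ω y hy => (hstep ω).add_half_sq_norm_le hψ ha hy
  · exact (((ContinuousLinearMap.measurable_apply y).comp hg).const_mul a).add
      (measurable_bregman hψ.differentiableOn hψ.convex hx hxX hy)
  · have hψc := hψ.differentiableOn.continuousOn
    unfold bregman
    fun_prop

theorem measurable_iterate (hψ : IsProxFunction ψ X) {a : ℝ} (ha : 0 < a) {Ξ : Type*}
    [MeasurableSpace Ξ] {sg : E → Ξ → E →L[ℝ] ℝ} (hsg : Measurable fun p : X × Ξ => sg p.1 p.2)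
    {ℱ : ℕ → MeasurableSpace Ω} (hℱ : Monotone ℱ) {ξ : ℕ → Ω → Ξ}
    (hξ : ∀ t, 1 ≤ t → Measurable[ℱ t] (ξ t)) {x : ℕ → Ω → E} (hx₁ : Measurable[ℱ 0] (x 1))
    (hx : ∀ ω, IsMirrorDescent ψ X a (fun t => sg (x t ω) (ξ t ω)) fun t => x t ω) (s : ℕ) :
    Measurable[ℱ s] (x (s + 1)) := by
  induction s with
  | zero => exact hx₁
  | succ s ih =>
    have hxs : Measurable[ℱ (s + 1)] (x (s + 1)) := ih.mono (hℱ s.le_succ) le_rfl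
    have hmem : ∀ ω, x (s + 1) ω ∈ X := fun ω => (hx ω).mem s.succ_pos
    have hg : Measurable[ℱ (s + 1)] fun ω => sg (x (s + 1) ω) (ξ (s + 1) ω) :=
      hsg.comp ((hxs.subtype_mk (h := hmem)).prodMk (hξ _ s.succ_pos))
    exact measurable_mirrorStep (m := ℱ (s + 1)) hψ (by positivity) hg hxs hmem
      fun ω => (hx ω).step _ s.succ_pos

end Measurability

section UniformBound

variable {Ω ι : Type*} [MeasurableSpace Ω] {μ : Measure Ω}

theorem exists_measurableSet_forall_of_ae [Countable ι] {ν : ι → Measure Ω} {q : Ω → Prop}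
    (h : ∀ i, ∀ᵐ z ∂ν i, q z) : ∃ A, MeasurableSet A ∧ (∀ i, ν i Aᶜ = 0) ∧ ∀ z ∈ A, q z := by
  obtain ⟨A, hAae, hA, hq⟩ := (Measure.ae_sum_iff.2 h).exists_measurable_mem
  exact ⟨A, hA, Measure.ae_sum_iff.1 hAae, hq⟩

theorem le_measureReal_forall_le [IsFiniteMeasure μ] [Nonempty ι] {Z : Ω → ℝ} (hZ : Measurable Z)
    {r : ι → ℝ} (hr : BddBelow (Set.range r)) {q : ℝ} (h : ∀ i, q ≤ μ.real {ω | Z ω ≤ r i}) :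
    q ≤ μ.real {ω | ∀ i, Z ω ≤ r i} := by
  let A : ℕ → Set Ω := fun k => {ω | Z ω ≤ (⨅ i, r i) + 1 / ((k : ℝ) + 1)}
  have hA : ∀ k, MeasurableSet (A k) := fun k => measurableSet_le hZ measurable_const
  have hanti : Antitone A := fun k l hkl ω (hω : Z ω ≤ _) =>
    hω.trans (add_le_add_right (by gcongr) _)
  have hq : ∀ k, q ≤ μ.real (A k) := fun k => by
    obtain ⟨i, hi⟩ := exists_lt_of_ciInf_lt
      (lt_add_of_pos_right (⨅ i, r i) (Nat.one_div_pos_of_nat (α := ℝ) (n := k)))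
    exact (h i).trans (measureReal_mono fun ω (hω : Z ω ≤ r i) => hω.trans hi.le)
  have hsub : ⋂ k, A k ⊆ {ω | ∀ i, Z ω ≤ r i} := fun ω hω i => by
    have hlim := (tendsto_one_div_add_atTop_nhds_zero_nat (𝕜 := ℝ)).const_add (⨅ i, r i)
    rw [add_zero] at hlim
    exact (ge_of_tendsto' hlim (Set.mem_iInter.1 hω)).trans (ciInf_le hr i)
  have hlim : Tendsto (fun k => μ.real (A k)) atTop (𝓝 (μ.real (⋂ k, A k))) :=
    (ENNReal.tendsto_toReal (measure_ne_top μ _)).comp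
      (tendsto_measure_iInter_atTop (fun k => (hA k).nullMeasurableSet) hanti
        ⟨0, measure_ne_top μ _⟩)
  exact (ge_of_tendsto' hlim hq).trans (measureReal_mono hsub)

end UniformBound

section Objective

variable {E : Type*} {X : Set E} {n : ℕ} {Ξ : Type*} [MeasurableSpace Ξ] {loc : Fin n → Measure Ξ}
  {F : E → Ξ → ℝ}

theorem objective_sub (hint : ∀ x ∈ X, ∀ i, Integrable (F x) (loc i)) {x y : E} (hx : x ∈ X)
    (hy : y ∈ X) : objective F loc x - objective F loc y =
      1 / (n : ℝ) * ∑ i, ∫ z, (F x z - F y z) ∂loc i := by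
  simp only [objective, ← mul_sub, ← Finset.sum_sub_distrib,
    integral_sub (hint x hx _) (hint y hy _)]

variable [NormedAddCommGroup E]

theorem abs_objective_sub_le [∀ i, IsProbabilityMeasure (loc i)] (hn : 0 < n)
    (hint : ∀ x ∈ X, ∀ i, Integrable (F x) (loc i)) {G : ℝ}
    (hLip : ∀ i, ∀ᵐ z ∂loc i, ∀ x ∈ X, ∀ y ∈ X, |F x z - F y z| ≤ G * ‖x - y‖) {x y : E}
    (hx : x ∈ X) (hy : y ∈ X) : |objective F loc x - objective F loc y| ≤ G * ‖x - y‖ := by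
  have hlocal : ∀ i, |∫ z, (F x z - F y z) ∂loc i| ≤ G * ‖x - y‖ := fun i => by
    have hbound : ∀ᵐ z ∂loc i, ‖F x z - F y z‖ ≤ G * ‖x - y‖ :=
      (hLip i).mono fun z hz => hz x hx y hy
    simpa using norm_integral_le_of_norm_le_const hbound
  rw [objective_sub hint hx hy, abs_mul, abs_of_nonneg (by positivity)]
  calc 1 / (n : ℝ) * |∑ i, ∫ z, (F x z - F y z) ∂loc i|
      ≤ 1 / (n : ℝ) * ∑ _i : Fin n, G * ‖x - y‖ := by
        gcongr
        exact (Finset.abs_sum_le_sum_abs _ _).trans (Finset.sum_le_sum fun i _ => hlocal i)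
    _ = G * ‖x - y‖ := by
        rw [Finset.sum_const, Finset.card_fin, nsmul_eq_mul, ← mul_assoc,
          one_div_mul_cancel (by positivity), one_mul]

theorem continuousOn_of_forall_abs_sub_le {f : E → ℝ} {G : ℝ} (hG : 0 ≤ G)
    (hf : ∀ x ∈ X, ∀ y ∈ X, |f x - f y| ≤ G * ‖x - y‖) : ContinuousOn f X :=
  (LipschitzOnWith.of_dist_le_mul (K := ⟨G, hG⟩) fun x hx y hy => by
    rw [Real.dist_eq, dist_eq_norm]
    exact hf x hx y hy).continuousOn

variable [NormedSpace ℝ E]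

theorem convexOn_integral {ν : Measure Ξ} (hX : Convex ℝ X)
    (hF : ∀ z, ConvexOn ℝ X fun x => F x z) (hint : ∀ x ∈ X, Integrable (F x) ν) :
    ConvexOn ℝ X fun x => ∫ z, F x z ∂ν := by
  refine ⟨hX, fun x hx y hy a b ha hb hab => ?_⟩
  simp only [smul_eq_mul]
  rw [← integral_const_mul, ← integral_const_mul,
    ← integral_add ((hint x hx).const_mul a) ((hint y hy).const_mul b)]
  exact integral_mono (hint _ (hX hx hy ha hb hab))
    (((hint x hx).const_mul a).add ((hint y hy).const_mul b)) fun z => (hF z).2 hx hy ha hb hab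

theorem convexOn_objective (hX : Convex ℝ X) (hF : ∀ z, ConvexOn ℝ X fun x => F x z)
    (hint : ∀ x ∈ X, ∀ i, Integrable (F x) (loc i)) : ConvexOn ℝ X (objective F loc) := by
  have hsum : ConvexOn ℝ X (∑ i, fun x => ∫ z, F x z ∂loc i) :=
    Finset.sum_induction _ (ConvexOn ℝ X) (fun _ _ => ConvexOn.add) (convexOn_const 0 hX)
      fun i _ => convexOn_integral hX hF fun x hx => hint x hx i
  refine (hsum.smul (by positivity : 0 ≤ 1 / (n : ℝ))).congr fun x _ => ?_
  simp only [Finset.sum_apply, smul_eq_mul, objective]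

theorem average_eq_sum_range (x : ℕ → E) (T : ℕ) :
    average x T = ∑ s ∈ Finset.range T, (1 / (T : ℝ)) • x (s + 1) := by
  rw [average, ← Finset.smul_sum, Finset.range_eq_Ico, Finset.sum_Ico_add' x 0 T 1, zero_add]
  rfl

theorem average_mem (hX : Convex ℝ X) {x : ℕ → E} (hx : ∀ t, 1 ≤ t → x t ∈ X) {T : ℕ}
    (hT : 0 < T) : average x T ∈ X := by
  rw [average_eq_sum_range]
  exact hX.sum_mem (fun _ _ => by positivity) (by simp; field_simp)
    fun s _ => hx _ s.succ_pos

theorem mul_average_sub_le {f : E → ℝ} (hf : ConvexOn ℝ X f) {x : ℕ → E}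
    (hx : ∀ t, 1 ≤ t → x t ∈ X) {T : ℕ} (hT : 0 < T) (b : ℝ) :
    T * (f (average x T) - b) ≤ ∑ s ∈ Finset.range T, (f (x (s + 1)) - b) := by
  have hT₀ : (0 : ℝ) < T := by exact_mod_cast hT
  have hjensen : f (average x T) ≤ 1 / (T : ℝ) * ∑ s ∈ Finset.range T, f (x (s + 1)) := by
    rw [average_eq_sum_range, Finset.mul_sum]
    exact hf.map_sum_le (fun _ _ => by positivity) (by simp; field_simp) fun s _ => hx _ s.succ_pos
  rw [Finset.sum_sub_distrib, Finset.sum_const, Finset.card_range, nsmul_eq_mul, mul_sub]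
  rw [one_div, ← div_eq_inv_mul, le_div_iff₀' hT₀] at hjensen
  linarith

end Objective

section DeviationBound

variable {Ω : Type*} {m0 : MeasurableSpace Ω} {μ : Measure Ω} [IsProbabilityMeasure μ]
  {ℱ : Filtration ℕ m0} {Y : ℕ → Ω → ℝ} {c : ℝ}

theorem one_sub_le_measureReal_sum_condExp_sub_le {d : ℕ}
    (hY : ∀ s, StronglyMeasurable[ℱ (s + (d + 1))] (Y s)) (hYc : ∀ s ω, |Y s ω| ≤ c) (hc : 0 < c)
    {N : ℕ} (hN : 0 < N) {δ : ℝ} (hδ : 0 < δ) (hδ1 : δ ≤ 1) :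
    1 - δ ≤ μ.real {ω | ∑ s ∈ Finset.range N, ((μ[Y s | ℱ s]) ω - Y s ω)
      ≤ c * √(2 * (d + 1) * (N + d : ℕ) * Real.log (1 / δ))} := by
  set γ := c * √(2 * (d + 1) * (N + d : ℕ) * Real.log (1 / δ)) with hγ
  have hlog : 0 ≤ Real.log (1 / δ) := Real.log_nonneg ((one_le_div hδ).2 hδ1)
  have hsub := (hasSubgaussianMGF_sum_sub_condExp (μ := μ) (c := ⟨c, hc.le⟩) hY
    (fun s => .of_forall (hYc s)) N).neg
  have htail := hsub.measure_ge_le (show 0 ≤ γ by positivity)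
  have hexp : Real.exp (-γ ^ 2 / (2 * ((d + 1) * (N + d) * c ^ 2))) = δ := by
    have hγ_sq : γ ^ 2 = c ^ 2 * (2 * (d + 1) * (N + d : ℕ) * Real.log (1 / δ)) := by
      rw [hγ, mul_pow, Real.sq_sqrt (by positivity)]
    have hexponent : -γ ^ 2 / (2 * ((d + 1) * (N + d) * c ^ 2)) = -Real.log (1 / δ) := by
      rw [hγ_sq, div_eq_iff (by positivity)]
      push_cast
      ring
    rw [hexponent, one_div, Real.log_inv, neg_neg, Real.exp_log hδ]
  have htail' : μ.real {ω | γ ≤ ∑ s ∈ Finset.range N, ((μ[Y s | ℱ s]) ω - Y s ω)} ≤ δ := by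
    refine le_trans (le_of_eq ?_) (htail.trans_eq ?_)
    · congr 1
      ext ω
      simp only [Set.mem_ofPred_eq, Pi.neg_apply, ← Finset.sum_neg_distrib, neg_sub]
    · exact hexp
  have hmeas : Measurable fun ω => ∑ s ∈ Finset.range N, ((μ[Y s | ℱ s]) ω - Y s ω) :=
    Finset.measurable_fun_sum _ fun s _ =>
      (stronglyMeasurable_condExp.mono (ℱ.le s)).measurable.sub
        ((hY s).mono (ℱ.le _)).measurable
  have hcompl := probReal_compl_eq_one_sub (μ := μ)
    (measurableSet_le (measurable_const (a := γ)) hmeas)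
  exact (sub_le_sub_left htail' 1).trans
    (hcompl.ge.trans (measureReal_mono fun ω (hω : ¬γ ≤ _) => (not_le.1 hω).le))

end DeviationBound

section StochasticLoss

variable {E Ξ : Type*} [NormedAddCommGroup E] [NormedSpace ℝ E] [MeasurableSpace E]
  [MeasurableSpace Ξ] {n : ℕ}

/-- The stochastic first-order oracle of the paper: convex losses `F · z` whose parameter `z` has
the laws `loc i`, and a measurable selection `sg` of subgradients, with Lipschitz constant and
subgradients bounded by `G` on `X` for almost every `z`. -/
structure IsStochasticLoss (loc : Fin n → Measure Ξ) (X : Set E) (F : E → Ξ → ℝ)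
    (sg : E → Ξ → E →L[ℝ] ℝ) (G : ℝ) : Prop where
  convexOn : ∀ z, ConvexOn ℝ X fun x => F x z
  measurable : ∀ x ∈ X, Measurable (F x)
  integrable : ∀ x ∈ X, ∀ i, Integrable (F x) (loc i)
  lipschitz : ∀ i, ∀ᵐ z ∂loc i, ∀ x ∈ X, ∀ y ∈ X, |F x z - F y z| ≤ G * ‖x - y‖
  measurable_subgradient : Measurable fun q : X × Ξ => sg q.1 q.2
  isSubgradientOn : ∀ z, ∀ x ∈ X, IsSubgradientOn (fun y => F y z) X x (sg x z)
  norm_subgradient_le : ∀ i, ∀ᵐ z ∂loc i, ∀ x ∈ X, ‖sg x z‖ ≤ G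

variable {loc : Fin n → Measure Ξ} {X : Set E} {F : E → Ξ → ℝ} {sg : E → Ξ → E →L[ℝ] ℝ} {G : ℝ}

namespace IsStochasticLoss

theorem nonneg [∀ i, IsProbabilityMeasure (loc i)] (hF : IsStochasticLoss loc X F sg G)
    (hn : 0 < n) (hX : X.Nonempty) : 0 ≤ G := by
  obtain ⟨x, hx⟩ := hX
  obtain ⟨z, hz⟩ := (hF.norm_subgradient_le ⟨0, hn⟩).exists
  exact (norm_nonneg _).trans (hz x hx)

theorem exists_measurableSet_regular (hF : IsStochasticLoss loc X F sg G) :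
    ∃ A, MeasurableSet A ∧ (∀ i, loc i Aᶜ = 0) ∧
      (∀ z ∈ A, ∀ x ∈ X, ∀ y ∈ X, |F x z - F y z| ≤ G * ‖x - y‖) ∧
      ∀ z ∈ A, ∀ x ∈ X, ‖sg x z‖ ≤ G := by
  obtain ⟨A, hA, hA₀, hAreg⟩ := exists_measurableSet_forall_of_ae fun i =>
    (hF.lipschitz i).and (hF.norm_subgradient_le i)
  exact ⟨A, hA, hA₀, fun z hz => (hAreg z hz).1, fun z hz => (hAreg z hz).2⟩

theorem objective_sub_le [∀ i, IsProbabilityMeasure (loc i)] (hF : IsStochasticLoss loc X F sg G)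
    (hn : 0 < n) (hG : 0 ≤ G) {R : ℝ} (hdiam : ∀ x ∈ X, ∀ y ∈ X, ‖x - y‖ ≤ R) {x y : E}
    (hx : x ∈ X) (hy : y ∈ X) : objective F loc x - objective F loc y ≤ G * R :=
  calc objective F loc x - objective F loc y ≤ G * ‖x - y‖ :=
        (le_abs_self _).trans (abs_objective_sub_le hn hF.integrable hF.lipschitz hx hy)
    _ ≤ G * R := by gcongr; exact hdiam x hx y hy

end IsStochasticLoss

end StochasticLoss

section LossGap

variable {E Ξ : Type*} {X : Set E} {F : E → Ξ → ℝ} {A : Set Ξ} {xs : E}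

/-- The excess loss `F y z - F xs z` as a function of `(y, z)`, cut off to zero outside of a set
`A` of parameters. On a set of full measure where the losses are Lipschitz, the cut-off makes it
bounded and continuous in `y` for every `z`. -/
def lossGap (F : E → Ξ → ℝ) (A : Set Ξ) (xs : E) (q : X × Ξ) : ℝ :=
  A.indicator (fun z => F q.1 z - F xs z) q.2

theorem lossGap_of_mem {z : Ξ} (hz : z ∈ A) (y : X) : lossGap F A xs (y, z) = F y z - F xs z :=
  Set.indicator_of_mem hz _

theorem lossGap_of_notMem {z : Ξ} (hz : z ∉ A) (y : X) : lossGap F A xs (y, z) = 0 :=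
  Set.indicator_of_notMem hz _

theorem mean_integral_lossGap [MeasurableSpace Ξ] {n : ℕ} {loc : Fin n → Measure Ξ}
    (hA₀ : ∀ i, loc i Aᶜ = 0) (hint : ∀ x ∈ X, ∀ i, Integrable (F x) (loc i)) (hxs : xs ∈ X)
    (y : X) : 1 / (n : ℝ) * ∑ i, ∫ z, lossGap F A xs (y, z) ∂loc i =
      objective F loc y - objective F loc xs := by
  have hlocal (i : Fin n) :
      ∫ z, lossGap F A xs (y, z) ∂loc i = ∫ z, (F y z - F xs z) ∂loc i :=
    integral_congr_ae <| (measure_eq_zero_iff_ae_notMem.1 (hA₀ i)).mono fun z hz =>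
      lossGap_of_mem (Set.notMem_compl_iff.1 hz) y
  simp only [objective_sub hint y.2 hxs, hlocal]

variable [NormedAddCommGroup E] {G : ℝ}

theorem abs_lossGap_le {R : ℝ} (hG : 0 ≤ G) (hR : 0 ≤ R) (hdiam : ∀ x ∈ X, ∀ y ∈ X, ‖x - y‖ ≤ R)
    (hLip : ∀ z ∈ A, ∀ x ∈ X, ∀ y ∈ X, |F x z - F y z| ≤ G * ‖x - y‖) (hxs : xs ∈ X)
    (q : X × Ξ) : |lossGap F A xs q| ≤ G * R := by
  obtain ⟨y, z⟩ := q
  by_cases hz : z ∈ A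
  · rw [lossGap_of_mem hz]
    exact (hLip z hz y y.2 xs hxs).trans (by gcongr; exact hdiam y y.2 xs hxs)
  · rw [lossGap_of_notMem hz, abs_zero]
    positivity

theorem measurable_lossGap [MeasurableSpace E] [BorelSpace E] [SecondCountableTopology E]
    [MeasurableSpace Ξ] (hA : MeasurableSet A) (hG : 0 ≤ G) (hF : ∀ x ∈ X, Measurable (F x))
    (hLip : ∀ z ∈ A, ∀ x ∈ X, ∀ y ∈ X, |F x z - F y z| ≤ G * ‖x - y‖) (hxs : xs ∈ X) :
    Measurable (lossGap F A xs : X × Ξ → ℝ) := by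
  refine measurable_uncurry_of_continuous_of_measurable (u := fun y z => lossGap F A xs (y, z))
    (fun z => ?_) fun y => ((hF y y.2).sub (hF xs hxs)).indicator hA
  by_cases hz : z ∈ A
  · simp only [lossGap_of_mem hz]
    exact (continuousOn_iff_continuous_domRestrict.1
      (continuousOn_of_forall_abs_sub_le hG (hLip z hz))).sub continuous_const
  · simp only [lossGap_of_notMem hz]
    exact continuous_const

variable [NormedSpace ℝ E]

theorem IsMirrorDescent.sum_delayed_lossGap_le {ψ : E → ℝ} {R a : ℝ} {sg : E → Ξ → E →L[ℝ] ℝ}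
    {ξ : ℕ → Ξ} {x : ℕ → E} (h : IsMirrorDescent ψ X a (fun t => sg (x t) (ξ t)) x)
    (hψ : IsProxFunction ψ X) (hD : ∀ x ∈ X, ∀ y ∈ X, bregman ψ X x y ≤ 1 / 2 * R ^ 2)
    (ha : 0 < a) (hG : 0 ≤ G)
    (hLip : ∀ z ∈ A, ∀ x ∈ X, ∀ y ∈ X, |F x z - F y z| ≤ G * ‖x - y‖)
    (hsub : ∀ z, ∀ x ∈ X, IsSubgradientOn (fun y => F y z) X x (sg x z))
    (hsg : ∀ z ∈ A, ∀ x ∈ X, ‖sg x z‖ ≤ G) (hξ : ∀ t, 1 ≤ t → ξ t ∈ A) (hxs : xs ∈ X)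
    (d N : ℕ) :
    ∑ s ∈ Finset.range N, lossGap F A xs (⟨x (s + 1), h.mem s.succ_pos⟩, ξ (s + (d + 1))) ≤
      (2 * d + 1) * (a * G ^ 2 * √(N : ℝ)) + √((N + d : ℕ) : ℝ) / a * (1 / 2 * R ^ 2) := by
  have hmem (s : ℕ) : ξ (s + (d + 1)) ∈ A := hξ _ (by omega)
  simp only [lossGap_of_mem (hmem _)]
  exact h.sum_delayed_loss_le hψ hD ha hG (fun t ht => hsg _ (hξ t ht) _ (h.mem ht))
    (φ := fun t y => F y (ξ t)) (fun t ht => hLip _ (hξ t ht))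
    (fun t ht => hsub _ _ (h.mem ht)) hxs d N

end LossGap

section HighProbability

variable {Ω Ξ : Type*} [MeasurableSpace Ω] [MeasurableSpace Ξ] {μ : Measure Ω}
  [IsProbabilityMeasure μ] {n : ℕ} {loc : Fin n → Measure Ξ} [∀ i, IsProbabilityMeasure (loc i)]
  {P : ℕ → Ω → Matrix (Fin n) (Fin n) ℝ} {token : ℕ → Ω → Fin n} {ξ : ℕ → Ω → Ξ}

theorem IsRandomMIGDSampling.abs_condExp_comp_sample_sub_mean_le
    (h : IsRandomMIGDSampling μ loc P token ξ) (hn : 2 ≤ n) (hlt : lambdaTwo hn μ (P 1) < 1)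
    {S : Type*} [MeasurableSpace S] (t : ℕ) {p : ℕ} (hp : 1 ≤ p) {y : Ω → S}
    (hy : Measurable[history P token ξ t] y) {H : S × Ξ → ℝ} (hH : Measurable H) {c : ℝ}
    (hc : ∀ q, |H q| ≤ c) :
    ∀ᵐ ω ∂μ, |(μ[fun ω => H (y ω, ξ (t + p) ω) | history P token ξ t]) ω
      - 1 / (n : ℝ) * ∑ i, ∫ z, H (y ω, z) ∂loc i| ≤ √(n * lambdaTwo hn μ (P 1) ^ p) * c := by
  filter_upwards [h.condExp_comp_sample t hp hy hH hc] with ω hω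
  rw [hω]
  refine abs_meanMatrix_pow_mulVec_sub_mean_le hn (h.measurable_matrix 1 le_rfl)
    (h.doublyStochastic 1 le_rfl) hlt (fun j => ?_) p _
  have hbound : ∀ᵐ z ∂loc j, ‖H (y ω, z)‖ ≤ c := ae_of_all _ fun z => hc (y ω, z)
  simpa using norm_integral_le_of_norm_le_const hbound

variable {E : Type*} [NormedAddCommGroup E] [NormedSpace ℝ E] [MeasurableSpace E] [BorelSpace E]
  [SecondCountableTopology E] {X : Set E} {ψ : E → ℝ} {F : E → Ξ → ℝ} {sg : E → Ξ → E →L[ℝ] ℝ}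
  {x : ℕ → Ω → E} {xs : E} {R G a : ℝ}

theorem one_sub_le_measureReal_sum_objective_sub_le (hn : 2 ≤ n)
    (h : IsRandomMIGDSampling μ loc P token ξ) (hlt : lambdaTwo hn μ (P 1) < 1)
    (hψ : IsProxFunction ψ X) (hR : 0 ≤ R)
    (hD : ∀ x ∈ X, ∀ y ∈ X, bregman ψ X x y ≤ 1 / 2 * R ^ 2)
    (hF : IsStochasticLoss loc X F sg G) (hGR : 0 < G * R) (ha : 0 < a)
    (hx₁ : Measurable[history P token ξ 0] (x 1))
    (hx : ∀ ω, IsMirrorDescent ψ X a (fun t => sg (x t ω) (ξ t ω)) fun t => x t ω)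
    (hxs : xs ∈ X) (d : ℕ) {N : ℕ} (hN : 0 < N) {δ : ℝ} (hδ : 0 < δ) (hδ1 : δ ≤ 1) :
    1 - δ ≤ μ.real {ω |
      ∑ s ∈ Finset.range N, (objective F loc (x (s + 1) ω) - objective F loc xs) ≤
        N * (√(n * lambdaTwo hn μ (P 1) ^ (d + 1)) * (G * R)) +
        G * R * √(2 * (d + 1) * (N + d : ℕ) * Real.log (1 / δ)) +
        ((2 * d + 1) * (a * G ^ 2 * √(N : ℝ)) +
          √((N + d : ℕ) : ℝ) / a * (1 / 2 * R ^ 2))} := by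
  obtain ⟨A, hA, hA₀, hLip, hsgG⟩ := hF.exists_measurableSet_regular
  have hG : 0 ≤ G := hF.nonneg (by omega) ⟨xs, hxs⟩
  have hdiam : ∀ x ∈ X, ∀ y ∈ X, ‖x - y‖ ≤ R := fun x hx y hy =>
    hψ.norm_sub_le_of_bregman_le hR hx hy (hD x hx y hy)
  have hH : Measurable (lossGap F A xs : X × Ξ → ℝ) :=
    measurable_lossGap hA hG hF.measurable hLip hxs
  have hHc := abs_lossGap_le (X := X) hG hR hdiam hLip hxs
  let y : ℕ → Ω → X := fun s ω => ⟨x (s + 1) ω, (hx ω).mem s.succ_pos⟩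
  have hy (s : ℕ) : Measurable[history P token ξ s] (y s) :=
    (measurable_iterate hψ ha hF.measurable_subgradient history_mono
      (fun _ => measurable_sample_history) hx₁ hx s).subtype_mk
  let Y : ℕ → Ω → ℝ := fun s ω => lossGap F A xs (y s ω, ξ (s + (d + 1)) ω)
  have hY (s : ℕ) : StronglyMeasurable[h.filtration (s + (d + 1))] (Y s) :=
    (hH.comp (((hy s).mono (history_mono (Nat.le_add_right _ _)) le_rfl).prodMk
      (measurable_sample_history (by omega)))).stronglyMeasurable
  have hbias := ae_all_iff.2 fun s =>
    h.abs_condExp_comp_sample_sub_mean_le hn hlt s (Nat.le_add_left 1 d) (hy s) hH hHc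
  refine (one_sub_le_measureReal_sum_condExp_sub_le hY (fun s ω => hHc _) hGR hN hδ hδ1).trans
    (ENNReal.toReal_mono (measure_ne_top _ _) (measure_mono_ae ?_))
  filter_upwards [h.ae_sample_mem hA hA₀, hbias] with ω hξA hbiasω hdev
  have hregret := (hx ω).sum_delayed_lossGap_le hψ hD ha hG hLip hF.isSubgradientOn hsgG hξA hxs
    d N
  have hterm (s : ℕ) : objective F loc (x (s + 1) ω) - objective F loc xs ≤
      √(n * lambdaTwo hn μ (P 1) ^ (d + 1)) * (G * R)
        + ((μ[Y s | h.filtration s]) ω - Y s ω) + Y s ω := by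
    have hmean := mean_integral_lossGap hA₀ hF.integrable hxs (y s ω)
    have := (abs_le.1 (hbiasω s)).1
    rw [hmean] at this
    change objective F loc (y s ω) - _ ≤ _ + ((μ[Y s | history P token ξ s]) ω - _) + _
    linarith
  refine (Finset.sum_le_sum fun s _ => hterm s).trans ?_
  rw [Finset.sum_add_distrib, Finset.sum_add_distrib, Finset.sum_const, Finset.card_range,
    nsmul_eq_mul]
  exact add_le_add (add_le_add le_rfl hdev) hregret

theorem one_sub_le_measureReal_objective_average_sub_le (hn : 2 ≤ n)
    (h : IsRandomMIGDSampling μ loc P token ξ) (hlt : lambdaTwo hn μ (P 1) < 1)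
    (hψ : IsProxFunction ψ X) (hR : 0 ≤ R)
    (hD : ∀ x ∈ X, ∀ y ∈ X, bregman ψ X x y ≤ 1 / 2 * R ^ 2)
    (hF : IsStochasticLoss loc X F sg G) (hGR : 0 < G * R) (ha : 0 < a)
    (hx₁ : Measurable[history P token ξ 0] (x 1))
    (hx : ∀ ω, IsMirrorDescent ψ X a (fun t => sg (x t ω) (ξ t ω)) fun t => x t ω)
    (hxs : xs ∈ X) {d T : ℕ} (hdT : d < T) {δ : ℝ} (hδ : 0 < δ) (hδ1 : δ ≤ 1) :
    1 - δ ≤ μ.real {ω |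
      T * (objective F loc (average (fun t => x t ω) T) - objective F loc xs) ≤
        d * (G * R) + T * (√(n * lambdaTwo hn μ (P 1) ^ (d + 1)) * (G * R)) +
        G * R * √(2 * (d + 1) * T * Real.log (1 / δ)) +
        ((2 * d + 1) * (a * G ^ 2 * √(T : ℝ)) + √(T : ℝ) / a * (1 / 2 * R ^ 2))} := by
  obtain ⟨N, rfl⟩ := Nat.exists_eq_add_of_le' hdT.le
  have hN : 0 < N := by omega
  have hG : 0 ≤ G := hF.nonneg (by omega) ⟨xs, hxs⟩
  have hdiam : ∀ x ∈ X, ∀ y ∈ X, ‖x - y‖ ≤ R := fun x hx y hy =>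
    hψ.norm_sub_le_of_bregman_le hR hx hy (hD x hx y hy)
  refine (one_sub_le_measureReal_sum_objective_sub_le hn h hlt hψ hR hD hF hGR ha hx₁ hx hxs d
    hN hδ hδ1).trans (measureReal_mono fun ω hω => ?_)
  rw [Set.mem_ofPred_eq] at hω ⊢
  have hjensen := mul_average_sub_le (convexOn_objective hψ.convex hF.convexOn hF.integrable)
    (fun t => (hx ω).mem) (hN.trans_le (N.le_add_right d)) (objective F loc xs)
  have hlast : ∑ s ∈ Finset.range d, (objective F loc (x (N + s + 1) ω) - objective F loc xs)
      ≤ d * (G * R) := by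
    simpa using Finset.sum_le_card_nsmul (Finset.range d) _ _ fun s _ =>
      hF.objective_sub_le (by omega) hG hdiam ((hx ω).mem (N + s).succ_pos) hxs
  rw [Finset.sum_range_add] at hjensen
  have hNT : (N : ℝ) ≤ (N + d : ℕ) := by exact_mod_cast N.le_add_right d
  have hbias : N * (√(n * lambdaTwo hn μ (P 1) ^ (d + 1)) * (G * R)) ≤
      (N + d : ℕ) * (√(n * lambdaTwo hn μ (P 1) ^ (d + 1)) * (G * R)) := by gcongr
  have hdrift : (2 * d + 1) * (a * G ^ 2 * √(N : ℝ)) ≤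
      (2 * d + 1) * (a * G ^ 2 * √((N + d : ℕ) : ℝ)) := by gcongr
  linarith

end HighProbability

section ErrorBound

/-- The right-hand side of the bound, with `C = 4`, in terms of the logarithmic factors `K` and
`M`. -/
def errorBound (R G a ε T K M : ℝ) : ℝ :=
  4 * (R ^ 2 / (a * √T) + K * (G ^ 2 * a / √T) + ε * G * R + G * R / √T * √(K * M))

variable {R G a ε T K M : ℝ}

theorem errorBound_nonneg (hR : 0 ≤ R) (hG : 0 ≤ G) (ha : 0 ≤ a) (hε : 0 ≤ ε) (hK : 0 ≤ K) :
    0 ≤ errorBound R G a ε T K M := by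
  unfold errorBound
  positivity

theorem lt_and_le_of_errorBound_lt (hR : 0 ≤ R) (hG : 0 ≤ G) (ha : 0 ≤ a) (hε : 0 ≤ ε)
    (hT : 0 < T) (hK : 0 ≤ K) (h : errorBound R G a ε T K M < G * R) :
    ε < 1 / 4 ∧ 16 * (K * M) ≤ T := by
  have hGR : 0 < G * R := (errorBound_nonneg hR hG ha hε hK).trans_lt h
  have hsqrt : 0 < √T := Real.sqrt_pos.2 hT
  have hprox : 0 ≤ R ^ 2 / (a * √T) := by positivity
  have hdrift : 0 ≤ K * (G ^ 2 * a / √T) := by positivity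
  have hbias : 0 ≤ G * R * ε := by positivity
  have hdev : 0 ≤ G * R * (√(K * M) / √T) := by positivity
  have hsum : errorBound R G a ε T K M = 4 * (R ^ 2 / (a * √T) + K * (G ^ 2 * a / √T) +
      G * R * ε + G * R * (√(K * M) / √T)) := by rw [errorBound]; ring
  rw [hsum] at h
  constructor
  · have : G * R * (4 * ε) < G * R := by linarith
    linarith [(mul_lt_iff_lt_one_right hGR).1 this]
  · have : G * R * (4 * √(K * M) / √T) < G * R := by rw [mul_div_assoc]; linarith
    have hlt : 4 * √(K * M) < √T := (div_lt_one hsqrt).1 ((mul_lt_iff_lt_one_right hGR).1 this)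
    rw [← Real.sqrt_le_sqrt_iff hT.le, Real.sqrt_mul (by norm_num),
      show (16 : ℝ) = 4 ^ 2 by norm_num, Real.sqrt_sq (by norm_num)]
    exact hlt.le

theorem mul_errorBound : T * errorBound R G a ε T K M =
    4 * (√T / a * R ^ 2 + K * (a * G ^ 2 * √T) + T * (ε * (G * R)) +
      G * R * (√T * √(K * M))) := by
  have hdiv : T * (1 / √T) = √T := by rw [mul_one_div, Real.div_sqrt]
  calc T * errorBound R G a ε T K M
      = 4 * (T * (1 / √T) / a * R ^ 2 + K * (a * G ^ 2 * (T * (1 / √T))) + T * (ε * (G * R)) +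
          G * R * (T * (1 / √T) * √(K * M))) := by rw [errorBound]; ring
    _ = _ := by rw [hdiv]

theorem le_errorBound_of_mul_le (hR : 0 ≤ R) (hG : 0 ≤ G) (ha : 0 < a) (hT : 0 < T) {d D β Z : ℝ}
    (hd : 0 ≤ d) (hdK : d + 1 ≤ 2 * K) (hD : 0 ≤ D) (hDM : D ≤ M) (hM : 1 / 2 ≤ M)
    (hKM : 16 * (K * M) ≤ T) (hβ : β ≤ 4 * ε)
    (hZ : T * Z ≤ d * (G * R) + T * (β * (G * R)) + G * R * √(2 * (d + 1) * T * D) +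
      ((2 * d + 1) * (a * G ^ 2 * √T) + √T / a * (1 / 2 * R ^ 2))) :
    Z ≤ errorBound R G a ε T K M := by
  have hK : 0 < K := by linarith
  refine le_of_mul_le_mul_left (hZ.trans ?_) hT
  rw [mul_errorBound]
  have hdev : √(2 * (d + 1) * T * D) ≤ 2 * (√T * √(K * M)) := by
    rw [← Real.sqrt_mul hT.le, Real.sqrt_le_left (by positivity), mul_pow,
      Real.sq_sqrt (by positivity)]
    have : (d + 1) * D ≤ 2 * K * M := mul_le_mul hdK hDM hD (by positivity)
    nlinarith
  have hK_le : K ≤ √T * √(K * M) := by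
    rw [← Real.sqrt_mul hT.le]
    apply Real.le_sqrt_of_sq_le
    calc K ^ 2 = 4 * (K * (1 / 2)) ^ 2 := by ring
      _ ≤ 16 * (K * M) * (K * M) := by
          have : (K * (1 / 2)) ^ 2 ≤ (K * M) ^ 2 := by gcongr
          nlinarith [sq_nonneg (K * M)]
      _ ≤ T * (K * M) := by gcongr
  have hlast : d * (G * R) ≤ 2 * (√T * √(K * M)) * (G * R) := by gcongr; linarith
  have hbias : T * (β * (G * R)) ≤ T * (4 * ε * (G * R)) := by gcongr
  have hdrift : (2 * d + 1) * (a * G ^ 2 * √T) ≤ 4 * K * (a * G ^ 2 * √T) := by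
    gcongr; linarith
  have hprox : 0 ≤ √T / a * R ^ 2 := by positivity
  have hdev' := mul_le_mul_of_nonneg_left hdev (mul_nonneg hG hR)
  linarith

end ErrorBound

section MixingScale

/-- The factor `(log (n / ε) + log (T / δ)) / (1 - lam)` of the bound, which controls the number of
steps within which a token with spectral quantity `lam = λ₂` gets mixed up to precision `ε`. -/
def mixingScale (n T : ℕ) (lam ε δ : ℝ) : ℝ :=
  (Real.log (n / ε) + Real.log (T / δ)) / (1 - lam)

variable {n T : ℕ} {lam ε δ : ℝ}

theorem mixingScale_eq (hn : 0 < n) (hT : 0 < T) (hε : 0 < ε) (hδ : 0 < δ) :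
    mixingScale n T lam ε δ = Real.log (T * n / (ε * δ)) / (1 - lam) := by
  rw [mixingScale, ← Real.log_mul (by positivity) (by positivity), div_mul_div_comm,
    mul_comm (n : ℝ)]

theorem mixingScale_nonneg (hlt : lam < 1) (hε : 0 < ε) (hδ : 0 < δ) (hεT : ε < n * T / δ) :
    0 ≤ mixingScale n T lam ε δ := by
  have hnT : (0 : ℝ) < n * T := (div_pos_iff_of_pos_right hδ).1 (hε.trans hεT)
  have hn : 0 < n := by by_contra! hn; simp_all
  have hT : 0 < T := by by_contra! hT; simp_all
  rw [mixingScale_eq hn hT hε hδ]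
  refine div_nonneg (Real.log_nonneg ((one_le_div (by positivity)).2 ?_)) (by linarith)
  rw [mul_comm (T : ℝ)]
  exact ((lt_div_iff₀ hδ).1 hεT).le

theorem log_div_le_mul_mixingScale (hlt : lam < 1) (hT : 0 < T) (hδ : 0 < δ) (hδ1 : δ ≤ 1) :
    Real.log (n / ε) ≤ (1 - lam) * mixingScale n T lam ε δ := by
  have hTδ : 0 ≤ Real.log (T / δ) := by
    refine Real.log_nonneg ((one_le_div hδ).2 (hδ1.trans ?_))
    exact_mod_cast hT
  rw [mixingScale, mul_div_cancel₀ _ (by linarith)]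
  linarith

theorem two_le_mixingScale (hn : 2 ≤ n) (h0 : 0 ≤ lam) (hlt : lam < 1) (hε : 0 < ε)
    (hε4 : ε < 1 / 4) (hT : 0 < T) (hδ : 0 < δ) (hδ1 : δ ≤ 1) :
    2 ≤ mixingScale n T lam ε δ := by
  have hn' : (2 : ℝ) ≤ n := by exact_mod_cast hn
  have height : Real.log 8 ≤ Real.log (n / ε) := by
    refine Real.log_le_log (by norm_num) ((le_div_iff₀ hε).2 ?_)
    linarith
  have hlog : Real.log 8 = 3 * Real.log 2 := by
    rw [show (8 : ℝ) = 2 ^ 3 by norm_num, Real.log_pow]; norm_num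
  nlinarith [log_div_le_mul_mixingScale (n := n) (ε := ε) hlt hT hδ hδ1, Real.log_two_gt_d9]

theorem mul_pow_le_sq_of_log_le {c : ℝ} (hc : 0 < c) (h0 : 0 ≤ lam) (hε : 0 < ε) {p : ℕ}
    (hp : Real.log c - 2 * Real.log ε ≤ (1 - lam) * p) : c * lam ^ p ≤ ε ^ 2 :=
  calc c * lam ^ p ≤ c * Real.exp (-(1 - lam)) ^ p := by
        gcongr
        linarith [Real.add_one_le_exp (-(1 - lam))]
    _ = Real.exp (Real.log c - (1 - lam) * p) := by
        rw [show Real.log c - (1 - lam) * p = Real.log c + p * (-(1 - lam)) by ring,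
          Real.exp_add, Real.exp_log hc, Real.exp_nat_mul]
    _ ≤ Real.exp (2 * Real.log ε) := Real.exp_le_exp.2 (by linarith)
    _ = ε ^ 2 := by rw [← Real.exp_log hε, ← Real.exp_nat_mul, Real.log_exp]; norm_num

theorem exists_delay_sqrt_mul_pow_le (hn : 2 ≤ n) (h0 : 0 ≤ lam) (hlt : lam < 1) (hε : 0 < ε)
    (hε4 : ε < 1 / 4) (hT : 0 < T) (hδ : 0 < δ) (hδ1 : δ ≤ 1) :
    ∃ d : ℕ, √(n * lam ^ (d + 1)) ≤ 4 * ε ∧ (d + 1 : ℝ) ≤ 2 * mixingScale n T lam ε δ := by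
  have hgap : 0 < 1 - lam := by linarith
  have hscale := log_div_le_mul_mixingScale (n := n) (ε := ε) hlt hT hδ hδ1
  rw [Real.log_div (by positivity) hε.ne'] at hscale
  have hlog : Real.log (4 * ε) = Real.log 4 + Real.log ε := Real.log_mul (by norm_num) hε.ne'
  have hlog4 : 1 ≤ 2 * Real.log 4 := by
    rw [show (4 : ℝ) = 2 ^ 2 by norm_num, Real.log_pow, Nat.cast_two]
    linarith [Real.log_two_gt_d9]
  have hneg : Real.log (4 * ε) ≤ 0 := Real.log_nonpos (by positivity) (by linarith)
  have hlogn : 0 ≤ Real.log n := Real.log_natCast_nonneg n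
  set q := (Real.log n - 2 * Real.log (4 * ε)) / (1 - lam)
  have hq₀ : 0 ≤ q := div_nonneg (by linarith) hgap.le
  have hgap_mul : (1 - lam) * q = Real.log n - 2 * Real.log (4 * ε) := mul_div_cancel₀ _ hgap.ne'
  refine ⟨⌊q⌋₊, ?_, ?_⟩
  · rw [Real.sqrt_le_left (by positivity)]
    refine mul_pow_le_sq_of_log_le (by positivity) h0 (by positivity) ?_
    rw [← hgap_mul]
    push_cast
    gcongr
    exact (Nat.lt_floor_add_one q).le
  · refine le_trans (add_le_add_left (Nat.floor_le hq₀) 1) (le_of_mul_le_mul_left ?_ hgap)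
    rw [mul_add, hgap_mul]
    linarith

theorem log_add_half_le_log_mul {b K : ℝ} (hb : 0 < b) (hK : 2 ≤ K) :
    Real.log b + 1 / 2 ≤ Real.log (b * K) := by
  rw [Real.log_mul hb.ne' (by linarith)]
  linarith [Real.log_le_log (by norm_num) hK, Real.log_two_gt_d9]

end MixingScale

section Competitor

variable {Ω Ξ : Type*} [MeasurableSpace Ω] [MeasurableSpace Ξ] {μ : Measure Ω}
  [IsProbabilityMeasure μ] {n : ℕ} {loc : Fin n → Measure Ξ} [∀ i, IsProbabilityMeasure (loc i)]
  {P : ℕ → Ω → Matrix (Fin n) (Fin n) ℝ} {token : ℕ → Ω → Fin n} {ξ : ℕ → Ω → Ξ}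
  {E : Type*} [NormedAddCommGroup E] [NormedSpace ℝ E] [MeasurableSpace E] [BorelSpace E]
  [SecondCountableTopology E] {X : Set E} {ψ : E → ℝ} {F : E → Ξ → ℝ} {sg : E → Ξ → E →L[ℝ] ℝ}
  {x : ℕ → Ω → E} {R G a : ℝ}

theorem one_sub_le_measureReal_objective_average_sub_le_errorBound (hn : 2 ≤ n)
    (h : IsRandomMIGDSampling μ loc P token ξ) (hlt : lambdaTwo hn μ (P 1) < 1)
    (hψ : IsProxFunction ψ X) (hR : 0 ≤ R)
    (hD : ∀ x ∈ X, ∀ y ∈ X, bregman ψ X x y ≤ 1 / 2 * R ^ 2)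
    (hF : IsStochasticLoss loc X F sg G) (ha : 0 < a)
    (hx₁ : Measurable[history P token ξ 0] (x 1))
    (hx : ∀ ω, IsMirrorDescent ψ X a (fun t => sg (x t ω) (ξ t ω)) fun t => x t ω)
    {xs : E} (hxs : xs ∈ X) {T : ℕ} (hT : 0 < T) {δ ε : ℝ} (hδ : 0 < δ) (hδ1 : δ ≤ 1)
    (hε : 0 < ε) (hεT : ε < n * T / δ) :
    1 - δ ≤ μ.real {ω |
      objective F loc (average (fun t => x t ω) T) ≤ objective F loc xs +
        errorBound R G a ε T (mixingScale n T (lambdaTwo hn μ (P 1)) ε δ)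
          (Real.log (1 / δ * mixingScale n T (lambdaTwo hn μ (P 1)) ε δ))} := by
  have hn₀ : 0 < n := by omega
  have hT' : (0 : ℝ) < T := by exact_mod_cast hT
  have hG : 0 ≤ G := hF.nonneg hn₀ ⟨xs, hxs⟩
  set K := mixingScale n T (lambdaTwo hn μ (P 1)) ε δ
  have hK₀ : 0 ≤ K := mixingScale_nonneg hlt hε hδ hεT
  rcases le_or_gt (G * R) (errorBound R G a ε T K (Real.log (1 / δ * K))) with hle | hgt
  · have hdiam : ∀ x ∈ X, ∀ y ∈ X, ‖x - y‖ ≤ R := fun x hx y hy =>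
      hψ.norm_sub_le_of_bregman_le hR hx hy (hD x hx y hy)
    calc 1 - δ ≤ 1 := by linarith
      _ = μ.real Set.univ := probReal_univ.symm
      _ ≤ _ := measureReal_mono fun ω _ => ?_
    rw [Set.mem_ofPred_eq]
    linarith [hF.objective_sub_le hn₀ hG hdiam
      (average_mem hψ.convex (fun t => (hx ω).mem) hT) hxs]
  · have h0 : 0 ≤ lambdaTwo hn μ (P 1) := lambdaTwo_nonneg hn
      (memLp_of_ae_mem_doublyStochastic (h.measurable_matrix 1 le_rfl)
        (h.doublyStochastic 1 le_rfl) 2)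
    obtain ⟨hε4, hKM⟩ := lt_and_le_of_errorBound_lt hR hG ha.le hε.le hT' hK₀ hgt
    have hK : 2 ≤ K := two_le_mixingScale hn h0 hlt hε hε4 hT hδ hδ1
    obtain ⟨d, hmix, hdK⟩ := exists_delay_sqrt_mul_pow_le hn h0 hlt hε hε4 hT hδ hδ1
    have hlog₀ : 0 ≤ Real.log (1 / δ) := Real.log_nonneg ((one_le_div hδ).2 hδ1)
    have hlog := log_add_half_le_log_mul (one_div_pos.2 hδ) hK
    have hdT : d < T := by
      have : (d : ℝ) < T := by nlinarith
      exact_mod_cast this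
    refine (one_sub_le_measureReal_objective_average_sub_le hn h hlt hψ hR hD hF
      ((errorBound_nonneg hR hG ha.le hε.le hK₀).trans_lt hgt) ha hx₁ hx hxs hdT hδ hδ1).trans
      (measureReal_mono fun ω hω => ?_)
    exact sub_le_iff_le_add'.1 <| le_errorBound_of_mul_le hR hG ha hT' d.cast_nonneg hdK hlog₀
      (by linarith) (by linarith) hKM hmix hω

end Competitor

section AllCompetitors

theorem four_mul_eq_errorBound {n T : ℕ} {lam R G a ε δ : ℝ} (hn : 0 < n) (hT : 0 < T)
    (hε : 0 < ε) (hδ : 0 < δ) :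
    4 * (R ^ 2 / (a * √(T : ℝ)) +
        (Real.log (n / ε) + Real.log (T / δ)) / (1 - lam) * (G ^ 2 * a / √(T : ℝ)) + ε * G * R +
        G * R / √(T : ℝ) * √(Real.log (T * n / (ε * δ)) *
          Real.log (1 / δ * Real.log (T * n / (ε * δ)) / (1 - lam)) / (1 - lam))) =
      errorBound R G a ε T (mixingScale n T lam ε δ)
        (Real.log (1 / δ * mixingScale n T lam ε δ)) := by
  rw [mul_div_right_comm (Real.log (T * n / (ε * δ))), mul_div_assoc (1 / δ),
    ← mixingScale_eq hn hT hε hδ, errorBound, mixingScale]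

variable {Ω E Ξ : Type*} [MeasurableSpace Ξ] [NormedAddCommGroup E] [NormedSpace ℝ E] {n : ℕ}
  {loc : Fin n → Measure Ξ} [∀ i, IsProbabilityMeasure (loc i)] [MeasurableSpace E] {X : Set E}
  {F : E → Ξ → ℝ} {sg : E → Ξ → E →L[ℝ] ℝ} {G : ℝ}

theorem IsStochasticLoss.bddBelow_range_objective_add (hF : IsStochasticLoss loc X F sg G)
    (hn : 0 < n) (hG : 0 ≤ G) {R : ℝ} (hdiam : ∀ x ∈ X, ∀ y ∈ X, ‖x - y‖ ≤ R) {ι : Type*}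
    {b : ι → ℝ} (hb : ∀ i, 0 ≤ b i) :
    BddBelow (Set.range fun q : X × ι => objective F loc q.1 + b q.2) := by
  rcases X.eq_empty_or_nonempty with rfl | ⟨x₀, hx₀⟩
  · simp [Set.range_eq_empty]
  · refine ⟨objective F loc x₀ - G * R, ?_⟩
    rintro _ ⟨⟨y, i⟩, rfl⟩
    linarith [hb i, hF.objective_sub_le hn hG hdiam hx₀ y.2]

theorem IsStochasticLoss.measurable_objective_average [MeasurableSpace Ω] [BorelSpace E]
    [SecondCountableTopology E] (hF : IsStochasticLoss loc X F sg G) (hn : 0 < n) (hG : 0 ≤ G)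
    (hX : Convex ℝ X) {x : ℕ → Ω → E} (hx : ∀ s, Measurable (x (s + 1)))
    (hxX : ∀ ω t, 1 ≤ t → x t ω ∈ X) {T : ℕ} (hT : 0 < T) :
    Measurable fun ω => objective F loc (average (fun t => x t ω) T) := by
  have havg : Measurable fun ω => average (fun t => x t ω) T := by
    simp only [average_eq_sum_range]
    exact Finset.measurable_fun_sum _ fun s _ => (hx s).const_smul (1 / (T : ℝ))
  exact measurable_comp_of_continuousOn (continuousOn_of_forall_abs_sub_le hG fun x hx y hy =>
    abs_objective_sub_le hn hF.integrable hF.lipschitz hx hy) havg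
    fun ω => average_mem hX (hxX ω) hT

end AllCompetitors

end RandomMIGD

end

open RandomMIGD in
theorem corollary5_general {E : Type*} [NormedAddCommGroup E] [NormedSpace ℝ E]
    [SecondCountableTopology E] [MeasurableSpace E] [BorelSpace E]
    {Ξ : Type*} [MeasurableSpace Ξ] {Ω : Type*} [MeasurableSpace Ω] {μ : Measure Ω}
    [IsProbabilityMeasure μ] {n : ℕ} (hn : 2 ≤ n) {loc : Fin n → Measure Ξ}
    [∀ i, IsProbabilityMeasure (loc i)] {P : ℕ → Ω → Matrix (Fin n) (Fin n) ℝ}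
    {token : ℕ → Ω → Fin n} {ξ : ℕ → Ω → Ξ}
    (h : IsRandomMIGDSampling μ loc P token ξ)
    (hlt : lambdaTwo hn μ (P 1) < 1) {X : Set E} {ψ : E → ℝ}
    (hψ : IsProxFunction ψ X) {R : ℝ} (hR : 0 ≤ R)
    (hD : ∀ x ∈ X, ∀ y ∈ X, bregman ψ X x y ≤ 1 / 2 * R ^ 2)
    {F : E → Ξ → ℝ} {sg : E → Ξ → E →L[ℝ] ℝ} {G : ℝ}
    (hF : IsStochasticLoss loc X F sg G) {a : ℝ} (ha : 0 < a) {x : ℕ → Ω → E}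
    (hx₁ : Measurable[history P token ξ 0] (x 1))
    (hx : ∀ ω, IsMirrorDescent ψ X a (fun t => sg (x t ω) (ξ t ω)) fun t => x t ω)
    {T : ℕ} (hT : 0 < T) {δ : ℝ} (hδ : 0 < δ) (hδ1 : δ ≤ 1) :
    1 - δ ≤ μ.real {ω | ∀ xs ∈ X, ∀ ε : ℝ, 0 < ε → ε < n * T / δ →
      objective F loc (RandomMIGD.average (fun t => x t ω) T)
          - objective F loc xs
        ≤ 4 * (R ^ 2 / (a * √(T : ℝ))
          + (Real.log (n / ε) + Real.log (T / δ)) / (1 - lambdaTwo hn μ (P 1))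
              * (G ^ 2 * a / √(T : ℝ))
          + ε * G * R
          + G * R / √(T : ℝ)
            * √(Real.log (T * n / (ε * δ))
                * Real.log (1 / δ * Real.log (T * n / (ε * δ))
                    / (1 - lambdaTwo hn μ (P 1)))
                / (1 - lambdaTwo hn μ (P 1))))} := by
  have hn₀ : 0 < n := by omega
  obtain ⟨ω₀⟩ : Nonempty Ω := nonempty_of_isProbabilityMeasure μ
  have hX₀ : x 1 ω₀ ∈ X := (hx ω₀).start_mem
  have hG : 0 ≤ G := hF.nonneg hn₀ ⟨_, hX₀⟩
  have hmeas (s : ℕ) : Measurable (x (s + 1)) :=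
    (measurable_iterate hψ ha hF.measurable_subgradient history_mono
      (fun _ => measurable_sample_history) hx₁ hx s).mono (h.history_le s) le_rfl
  have : Nonempty (X × Set.Ioo (0 : ℝ) (n * T / δ)) :=
    ⟨⟨_, hX₀⟩, (Set.nonempty_Ioo.2 (by positivity)).some, Set.Nonempty.some_mem _⟩
  have hbdd := hF.bddBelow_range_objective_add hn₀ hG
    (fun x hx y hy => hψ.norm_sub_le_of_bregman_le hR hx hy (hD x hx y hy))
    (b := fun ε : Set.Ioo (0 : ℝ) (n * T / δ) =>
      errorBound R G a ε T (mixingScale n T (lambdaTwo hn μ (P 1)) ε δ)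
        (Real.log (1 / δ * mixingScale n T (lambdaTwo hn μ (P 1)) ε δ)))
    fun ε => errorBound_nonneg hR hG ha.le ε.2.1.le (mixingScale_nonneg hlt ε.2.1 hδ ε.2.2)
  refine (le_measureReal_forall_le
    (hF.measurable_objective_average hn₀ hG hψ.convex hmeas (fun ω _ => (hx ω).mem) hT) hbdd
    fun q => one_sub_le_measureReal_objective_average_sub_le_errorBound hn h hlt hψ hR hD hF ha
      hx₁ hx q.1.2 hT hδ hδ1 q.2.2.1 q.2.2.2).trans
    (measureReal_mono fun ω hω xs hxs ε hε hεT => ?_)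
  rw [four_mul_eq_errorBound hn₀ hT hε hδ, sub_le_iff_le_add']
  exact hω ⟨⟨xs, hxs⟩, ε, hε, hεT⟩

theorem corollary5 :
    ∃ C : ℝ, 0 < C ∧ C ≤ 4 ∧
      ∀ {E : Type*} [NormedAddCommGroup E] [NormedSpace ℝ E] [FiniteDimensional ℝ E]
        [MeasurableSpace E] [BorelSpace E]
        {Ξ : Type*} [MeasurableSpace Ξ]
        {Ω : Type*} [MeasurableSpace Ω] (μ : Measure Ω) [IsProbabilityMeasure μ]
        -- the network, the local distributions, and the random token and sample process
        (n : ℕ) (hn : 2 ≤ n)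
        (loc : Fin n → Measure Ξ) (_ : ∀ i, IsProbabilityMeasure (loc i))
        (P : ℕ → Ω → Matrix (Fin n) (Fin n) ℝ) (token : ℕ → Ω → Fin n) (ξ : ℕ → Ω → Ξ)
        (_ : RandomMIGD.IsRandomMIGDSampling μ loc P token ξ)
        (_ : RandomMIGD.lambdaTwo hn μ (P 1) < 1)
        -- the domain and the prox-function
        (X : Set E) (_ : IsCompact X) (_ : Convex ℝ X)
        (ψ : E → ℝ) (_ : DifferentiableOn ℝ ψ X) (_ : StrongConvexOn X 1 ψ)
        (R : ℝ) (_ : 0 ≤ R)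
        (_ : ∀ x ∈ X, ∀ y ∈ X, RandomMIGD.bregman ψ X x y ≤ (1 / 2) * R ^ 2)
        -- the convex functions, with a measurable selection of subgradients
        (F : E → Ξ → ℝ) (_ : ∀ z, ConvexOn ℝ X fun x => F x z)
        (_ : ∀ x ∈ X, Measurable (F x)) (_ : ∀ x ∈ X, ∀ i, Integrable (F x) (loc i))
        (G : ℝ) (_ : ∀ i, ∀ᵐ z ∂(loc i), ∀ x ∈ X, ∀ y ∈ X, |F x z - F y z| ≤ G * ‖x - y‖)
        (sg : E → Ξ → E →L[ℝ] ℝ) (_ : Measurable fun p : X × Ξ => sg p.1 p.2)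
        (_ : ∀ z, ∀ x ∈ X, RandomMIGD.IsSubgradientOn (fun y => F y z) X x (sg x z))
        (_ : ∀ i, ∀ᵐ z ∂(loc i), ∀ x ∈ X, ‖sg x z‖ ≤ G)
        -- the algorithm, with step sizes `a / √t`
        (a : ℝ) (_ : 0 < a) (x₁ : E) (_ : x₁ ∈ X)
        (x : ℕ → Ω → E) (_ : ∀ ω, x 1 ω = x₁)
        (_ : ∀ t : ℕ, 1 ≤ t → ∀ ω, RandomMIGD.IsMirrorStep ψ X (a / √(t : ℝ))
          (sg (x t ω) (ξ t ω)) (x t ω) (x (t + 1) ω))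
        -- the horizon and the confidence level
        (T : ℕ) (_ : 1 ≤ T) (δ : ℝ) (_ : 0 < δ) (_ : δ ≤ 1),
        1 - δ ≤ μ.real {ω | ∀ xs ∈ X, ∀ ε : ℝ, 0 < ε → ε < n * T / δ →
          RandomMIGD.objective F loc (RandomMIGD.average (fun t => x t ω) T)
              - RandomMIGD.objective F loc xs
            ≤ C * (R ^ 2 / (a * √(T : ℝ))
              + (Real.log (n / ε) + Real.log (T / δ)) / (1 - RandomMIGD.lambdaTwo hn μ (P 1))
                  * (G ^ 2 * a / √(T : ℝ))
              + ε * G * R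
              + G * R / √(T : ℝ)
                * √(Real.log (T * n / (ε * δ))
                    * Real.log (1 / δ * Real.log (T * n / (ε * δ))
                        / (1 - RandomMIGD.lambdaTwo hn μ (P 1)))
                    / (1 - RandomMIGD.lambdaTwo hn μ (P 1))))} := by
  refine ⟨4, by norm_num, le_rfl, ?_⟩
  intro E _ _ _ _ _ Ξ _ Ω _ μ _ n hn loc _ P token ξ h hlt X _ _ ψ hψ hψc R hR hD F hFc hF hint G
    hLip sg hsg hsub hsgG a ha x₁ hx₁ x hx₁_eq hstep T hT δ hδ hδ1
  have := FiniteDimensional.proper_real E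
  have hconst : x 1 = fun _ => x₁ := funext hx₁_eq
  exact corollary5_general hn h hlt ⟨hψ, hψc⟩ hR hD ⟨hFc, hF, hint, hLip, hsg, hsub, hsgG⟩ ha
    (hconst ▸ measurable_const) (fun ω => ⟨hx₁_eq ω ▸ hx₁, fun t ht => hstep t ht ω⟩) hT hδ hδ1
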